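/- Fix a density $\rho\in(0,1)$ and consider integers $N\ge1$ and $p=\rho N$ (those $N$ for which $\rho N$ is an integer). Arguments and logarithms are principal, $\arg z\in(-\pi,\pi]$. Put $r_{\mathrm{cr}}=2^{1/\rho}\rho(1-\rho)^{1/\rho-1}$. For $C\in\mathbb C$ and $j=1,\dots,N$ define $u_j(C)$ as follows. Let $F(u)=\frac p\pi\arg(u-1)+\frac{N-p}\pi\arg(u+1)$ and let $I_j\subset(-N,N]$ be the image of $(-p+2(j-1),-p+2j]$ under reduction modulo $2N$. If $C\notin\mathbb R_{\ge0}$, $u_j(C)$ is the unique solution of $(1-u)^p(1+u)^{N-p}=C$ with $F(u)\in I_j$; if $C>0$, $u_j(C)=\lim_{\delta\uparrow0}u_j(Ce^{i\delta})$; and $u_j(0)=1$ for $j\le p$, $u_j(0)=-1$ for $j>p$. Put $$G_N(C)=\frac1p\sum_{j=1}^p\log(1+u_j(C))-\log2,\qquad \Lambda_N(C)=\frac12\sum_{j=1}^p(u_j(C)-1).$$ For $r>r_{\mathrm{cr}}$ let $u_*(r)$ be the unique $u$ with $\Im u>0$, $(1-u)^\rho(1+u)^{1-\rho}=r^\rho$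 and $\rho\arg(1-u)+(1-\rho)\arg(1+u)=0$, and put $$G_\infty(z)=\frac1\pi\Big\{\frac{1-\rho}\rho\log|1+z|\arg(1+z)+\log2\,\arg(1-z)-\Im\operatorname{Li}_2\Big(\frac12-\frac z2\Big)\Big\},\qquad \Lambda_\infty(z)=\frac1\pi\Big\{\frac{\Im z}2+(\rho-1)\arg(1+z)\Big\},$$ where $\operatorname{Li}_2(z)=-\int_0^z\frac{\log(1-u)}u\,du$ for $z\in\mathbb C\setminus[1,\infty)$. Then for every compact set $K\subset\mathbb R$ there is a constant $B=B(\rho,K)$ such that for all such $N,p$ and all real $C\le r_{\mathrm{cr}}^p$, with $r=|C|^{1/p}$, for which $C\in K$ or $r\in K$, $$\big|G_N(C)-\mathbf 1_{\{r>r_{\mathrm{cr}}\}}G_\infty(u_*(r))\big|\le\frac BN,\qquad \big|\Lambda_N(C)-N\,\mathbf 1_{\{r>r_{\mathrm{cr}}\}}\Lambda_\infty(u_*(r))\big|\le B.$$ -/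

import Mathlib

open Filter Topology

noncomputable section

namespace TASEP

/-- The critical focal radius `r_cr = 2^(1/ρ) ρ (1-ρ)^(1/ρ-1)`. -/
def rCrit (ρ : ℝ) : ℝ :=
  (2 : ℝ) ^ (1 / ρ) * ρ * (1 - ρ) ^ (1 / ρ - 1)

/-- `u` solves the decoupled Bethe equation `(1-u)^p (1+u)^(N-p) = C`. -/
def IsBetheRoot (N p : ℕ) (C u : ℂ) : Prop :=
  (1 - u) ^ p * (1 + u) ^ (N - p) = C

/-- The labelling function `F(u) = (p/π) arg(u-1) + ((N-p)/π) arg(u+1)`, principal arguments. -/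
def labelFun (N p : ℕ) (u : ℂ) : ℝ :=
  (p : ℝ) / Real.pi * (u - 1).arg + ((N : ℝ) - p) / Real.pi * (u + 1).arg

/-- The interval `I_j`: the image of `(-p+2(j-1), -p+2j]` under reduction modulo `2N` to the
representatives in `(-N, N]`. -/
def labelInterval (N p j : ℕ) : Set ℝ :=
  {x | x ∈ Set.Ioc (-(N : ℝ)) N ∧
    ∃ k : ℤ, x + 2 * (N : ℝ) * k ∈ Set.Ioc (-(p : ℝ) + 2 * ((j : ℝ) - 1)) (-(p : ℝ) + 2 * j)}

/-- The solution `u` of the Bethe equation with `F(u) ∈ I_j`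
(it is unique when `C` is not a nonnegative real). -/
def slitRoot (N p j : ℕ) (C : ℂ) : ℂ :=
  Classical.epsilon fun u : ℂ => IsBetheRoot N p C u ∧ labelFun N p u ∈ labelInterval N p j

/-- The solution map `u_j(C)`, `1 ≤ j ≤ N`: the root labelled by `I_j` if `C` is not a nonnegative
real, the limit from `Im C < 0` if `C > 0`, and, for `C = 0`, the root `1` for the first `p`
labels and `-1` for the others. -/
def betheRoot (N p j : ℕ) (C : ℂ) : ℂ :=
  if C = 0 then (if j ≤ p then 1 else -1)
  else if C.im = 0 ∧ 0 < C.re then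
    limUnder (𝓝[<] (0 : ℝ)) fun δ : ℝ => slitRoot N p j (C * Complex.exp (δ * Complex.I))
  else slitRoot N p j C

/-- `G_N(C) = (1/p) ∑_{j=1}^p log(1+u_j(C)) - log 2`. -/
def GN (N p : ℕ) (C : ℂ) : ℂ :=
  1 / (p : ℂ) * ∑ j ∈ Finset.Icc 1 p, Complex.log (1 + betheRoot N p j C) - Complex.log 2

/-- `Λ_N(C) = (1/2) ∑_{j=1}^p (u_j(C)-1)`. -/
def LambdaN (N p : ℕ) (C : ℂ) : ℂ :=
  1 / 2 * ∑ j ∈ Finset.Icc 1 p, (betheRoot N p j C - 1)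

/-- The dilogarithm `Li₂(z) = -∫_0^z log(1-u)/u du` for `z ∉ [1, ∞)`, the integral being taken
along the segment `u = t z`, `0 ≤ t ≤ 1`. -/
def dilog (z : ℂ) : ℂ :=
  -∫ t in (0 : ℝ)..1, Complex.log (1 - t * z) / t

/-- The function `G_∞`. -/
def GInf (ρ : ℝ) (z : ℂ) : ℝ :=
  1 / Real.pi * ((1 - ρ) / ρ * Real.log ‖1 + z‖ * (1 + z).arg
    + Real.log 2 * (1 - z).arg - (dilog (1 / 2 - z / 2)).im)

/-- The function `Λ_∞`. -/
def LambdaInf (ρ : ℝ) (z : ℂ) : ℝ :=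
  1 / Real.pi * (z.im / 2 + (ρ - 1) * (1 + z).arg)

/-- The system that characterizes `u_*(r)` for `r > r_cr`. -/
def IsUStar (ρ r : ℝ) (u : ℂ) : Prop :=
  (1 - u) ^ (ρ : ℂ) * (1 + u) ^ ((1 - ρ : ℝ) : ℂ) = ((r ^ ρ : ℝ) : ℂ) ∧
    ρ * (1 - u).arg + (1 - ρ) * (1 + u).arg = 0 ∧ 0 < u.im

/-- The point `u_*(r)`, `r ≥ r_cr`, with `u_*(r_cr) = 1 - 2ρ`. -/
def uStar (ρ r : ℝ) : ℂ :=
  if r = rCrit ρ then ((1 - 2 * ρ : ℝ) : ℂ) else Classical.epsilon (IsUStar ρ r)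

/-- `1_{r > r_cr} G_∞(u_*(r))`. -/
def GLimit (ρ r : ℝ) : ℝ :=
  if rCrit ρ < r then GInf ρ (uStar ρ r) else 0

/-- `1_{r > r_cr} Λ_∞(u_*(r))`. -/
def LambdaLimit (ρ r : ℝ) : ℝ :=
  if rCrit ρ < r then LambdaInf ρ (uStar ρ r) else 0

end TASEP

end

/-! Write W(u) = ρ log(1-u) + (1-ρ) log(1+u), which is `logLevel`. In the upper half plane Im W' <
0, so W is injective there, and a root of the Bethe equation with |C| = r^p is fixed by two real
data: the modulus of the equation gives Re W = ρ log r, and the label x = F(u) gives Im W = ψ - ρπ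
with ψ = πx/N. Roots with labels in (0,p) are therefore samples, at spacing 2π/N in ψ, of one curve
`levelPoint ρ r ψ`, 0 < ψ < ρπ, that does not depend on N. Roots with negative labels are conjugates
of such samples, and at most two further labels (0 and p) sit at the ends of the curve.

Along the curve dW = i dψ, so if A' = f W', then Im A has derivative Re f. A sum of f over the roots
is thus a Riemann sum for a difference of boundary values of Im A. For f = u-1 and f = log(1+u) the
real part of f is monotone along the curve, so this sum differs from its limit by a fixed multiple
of sup |f|, with no loss in N (`norm_sum_labels_sub_le`). The primitives `primLambda` and `primG`
are explicit.

The end ψ = 0 lies on the real axis. The end ψ = ρπ is u_*(r) if r > r_cr and is real if r ≤ r_cr,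
by concavity of the sine (`levelDefect_crit_pos`, `exists_levelDefect_crit_neg`). This dichotomy is
the indicator in the limit. Uniformity in r comes from `norm_le_of_logLevel_re` and from
`distBound_le_norm`, which keeps the roots away from -1. -/

noncomputable section

namespace TASEP

/-! ### The level function and its injectivity -/

/-- The multivalued function `log ((1-u)^ρ (1+u)^(1-ρ))`, in its principal branch. -/
def logLevel (ρ : ℝ) (u : ℂ) : ℂ :=
  ρ * Complex.log (1 - u) + (1 - ρ) * Complex.log (1 + u)

/-- The derivative of `logLevel`. -/
def logLevelDeriv (ρ : ℝ) (u : ℂ) : ℂ :=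
  -ρ * (1 - u)⁻¹ + (1 - ρ) * (1 + u)⁻¹

lemma one_sub_mem_slitPlane {u : ℂ} (hu : 0 < u.im) : 1 - u ∈ Complex.slitPlane := by
  right; simp; exact hu.ne'

lemma one_add_mem_slitPlane {u : ℂ} (hu : 0 < u.im) : 1 + u ∈ Complex.slitPlane := by
  right; simp; exact hu.ne'

lemma one_sub_ne_zero_of_im_pos {u : ℂ} (hu : 0 < u.im) : 1 - u ≠ 0 :=
  Complex.slitPlane_ne_zero (one_sub_mem_slitPlane hu)

lemma one_add_ne_zero_of_im_pos {u : ℂ} (hu : 0 < u.im) : 1 + u ≠ 0 :=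
  Complex.slitPlane_ne_zero (one_add_mem_slitPlane hu)

lemma hasStrictDerivAt_log_one_sub {u : ℂ} (hu : 0 < u.im) :
    HasStrictDerivAt (fun u : ℂ => Complex.log (1 - u)) (-(1 - u)⁻¹) u := by
  have h := ((hasStrictDerivAt_id u).const_sub 1).clog (one_sub_mem_slitPlane hu)
  simpa [neg_div] using h

lemma hasStrictDerivAt_log_one_add {u : ℂ} (hu : 0 < u.im) :
    HasStrictDerivAt (fun u : ℂ => Complex.log (1 + u)) ((1 + u)⁻¹) u := by
  have h := ((hasStrictDerivAt_id u).const_add 1).clog (one_add_mem_slitPlane hu)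
  simpa using h

lemma hasStrictDerivAt_logLevel (ρ : ℝ) {u : ℂ} (hu : 0 < u.im) :
    HasStrictDerivAt (logLevel ρ) (logLevelDeriv ρ u) u := by
  have h := ((hasStrictDerivAt_log_one_sub hu).const_mul (ρ : ℂ)).add
    ((hasStrictDerivAt_log_one_add hu).const_mul (1 - ρ : ℂ))
  refine h.congr_deriv ?_
  unfold logLevelDeriv; ring

lemma im_inv_one_sub_pos {u : ℂ} (hu : 0 < u.im) : 0 < ((1 - u)⁻¹).im := by
  rw [Complex.inv_im]
  have : 0 < Complex.normSq (1 - u) := Complex.normSq_pos.2 (one_sub_ne_zero_of_im_pos hu)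
  simp; positivity

lemma im_inv_one_add_neg {u : ℂ} (hu : 0 < u.im) : ((1 + u)⁻¹).im < 0 := by
  rw [Complex.inv_im]
  have : 0 < Complex.normSq (1 + u) := Complex.normSq_pos.2 (one_add_ne_zero_of_im_pos hu)
  have h2 : 0 < u.im / Complex.normSq (1 + u) := by positivity
  simp only [Complex.add_im, Complex.one_im, zero_add, neg_div]; linarith

/-- Both -ρ/(1-u) and (1-ρ)/(1+u) have negative imaginary part above the real axis. This sign yields
injectivity, and also monotonicity of Re u along the level curve. -/
lemma logLevelDeriv_im_neg {ρ : ℝ} (hρ0 : 0 < ρ) (hρ1 : ρ < 1) {u : ℂ} (hu : 0 < u.im) :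
    (logLevelDeriv ρ u).im < 0 := by
  have h1 := im_inv_one_sub_pos hu
  have h2 := im_inv_one_add_neg hu
  have : (logLevelDeriv ρ u).im = -ρ * ((1 - u)⁻¹).im + (1 - ρ) * ((1 + u)⁻¹).im := by
    have e : logLevelDeriv ρ u = ((-ρ : ℝ) : ℂ) * (1 - u)⁻¹ + ((1 - ρ : ℝ) : ℂ) * (1 + u)⁻¹ := by
      simp [logLevelDeriv]
    rw [e, Complex.add_im, Complex.im_ofReal_mul, Complex.im_ofReal_mul]
  rw [this]; nlinarith

lemma logLevelDeriv_ne_zero {ρ : ℝ} (hρ0 : 0 < ρ) (hρ1 : ρ < 1) {u : ℂ} (hu : 0 < u.im) :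
    logLevelDeriv ρ u ≠ 0 := by
  intro h
  have := logLevelDeriv_im_neg hρ0 hρ1 hu
  rw [h] at this; simp at this

/-- `logLevel` is injective on the upper half plane, since the imaginary part of its derivative
has a constant sign there. -/
lemma logLevel_injOn {ρ : ℝ} (hρ0 : 0 < ρ) (hρ1 : ρ < 1) :
    Set.InjOn (logLevel ρ) {u : ℂ | 0 < u.im} := by
  intro a ha b hb hab
  by_contra hne
  have hba : b - a ≠ 0 := sub_ne_zero.2 (Ne.symm hne)
  let γ : ℝ → ℂ := fun t => a + t * (b - a)
  have hγ : ∀ t ∈ Set.Icc (0 : ℝ) 1, 0 < (γ t).im := by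
    intro t ht
    have e : (γ t).im = (1 - t) * a.im + t * b.im := by
      simp [γ]; ring
    rw [e]
    have ha' : 0 < a.im := ha
    have hb' : 0 < b.im := hb
    rcases eq_or_lt_of_le ht.1 with h | h
    · rw [← h]; simpa using ha'
    · have := ht.2
      nlinarith [mul_pos h hb', mul_nonneg (sub_nonneg.2 this) ha'.le]
  have hγd : ∀ t : ℝ, HasDerivAt γ (b - a) t := by
    intro t
    have := ((Complex.ofRealCLM.hasDerivAt (x := t)).mul_const (b - a)).const_add a
    simpa [γ] using this
  -- Dividing by b - a cancels the chain rule factor, so the derivative of k is exactly the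
  -- imaginary part of W'.
  let k : ℝ → ℝ := fun t => (logLevel ρ (γ t) / (b - a)).im
  have hk : ∀ t ∈ Set.Icc (0 : ℝ) 1, HasDerivAt k ((logLevelDeriv ρ (γ t)).im) t := by
    intro t ht
    have h1 := ((hasStrictDerivAt_logLevel ρ (hγ t ht)).hasDerivAt.comp t (hγd t)).div_const (b - a)
    have h2 := Complex.imCLM.hasFDerivAt.comp_hasDerivAt t h1
    simpa [k, Function.comp_def, hba] using h2
  have hanti : StrictAntiOn k (Set.Icc 0 1) := by
    apply strictAntiOn_of_deriv_neg (convex_Icc 0 1)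
    · exact fun t ht => (hk t ht).continuousAt.continuousWithinAt
    · intro t ht
      have ht' := interior_subset ht
      rw [(hk t ht').deriv]
      exact logLevelDeriv_im_neg hρ0 hρ1 (hγ t ht')
  have := hanti (Set.left_mem_Icc.2 zero_le_one) (Set.right_mem_Icc.2 zero_le_one) zero_lt_one
  simp [k, γ, hab] at this

/-! ### Existence of points with prescribed level and weighted angle -/

/-- A point of the upper half plane given by its viewing angles `α` from `-1` and `β` from `1`. -/
lemma exists_point_of_angles {ρ r ψ α β : ℝ} (hr : 0 < r) (hα : 0 < α)
    (hαβ : α < β) (hβ : β < Real.pi) (hψ : ρ * β + (1 - ρ) * α = ψ)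
    (h : 2 * Real.sin α ^ ρ * Real.sin β ^ (1 - ρ) = r ^ ρ * Real.sin (β - α)) :
    ∃ u : ℂ, 0 < u.im ∧ (1 + u).arg = α ∧
      logLevel ρ u = ((ρ * Real.log r : ℝ) : ℂ) + ((ψ - ρ * Real.pi : ℝ) : ℂ) * Complex.I := by
  have hsα : 0 < Real.sin α := Real.sin_pos_of_pos_of_lt_pi hα (hαβ.trans hβ)
  have hsβ : 0 < Real.sin β := Real.sin_pos_of_pos_of_lt_pi (hα.trans hαβ) hβ
  have hsd : 0 < Real.sin (β - α) := Real.sin_pos_of_pos_of_lt_pi (by linarith) (by linarith)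
  -- Law of sines in the triangle -1, 1, u, with base 2 and angle β - α at u: t is |1+u| and s is
  -- |1-u|.
  set t : ℝ := 2 * Real.sin β / Real.sin (β - α) with ht
  set s : ℝ := 2 * Real.sin α / Real.sin (β - α) with hs
  have htp : 0 < t := by positivity
  have hsp : 0 < s := by positivity
  let u : ℂ := -1 + t * (Complex.cos α + Complex.sin α * Complex.I)
  have h1 : 1 + u = t * (Complex.cos α + Complex.sin α * Complex.I) := by simp [u]
  have h2 : 1 - u = s * (Complex.cos ((β - Real.pi : ℝ) : ℂ)
      + Complex.sin ((β - Real.pi : ℝ) : ℂ) * Complex.I) := by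
    have e1 : 1 - u = 2 - t * (Complex.cos α + Complex.sin α * Complex.I) := by simp [u]; ring
    rw [e1]
    have hre : 2 - t * Real.cos α = -(s * Real.cos β) := by
      rw [ht, hs]; field_simp; rw [Real.sin_sub]; ring
    have him : t * Real.sin α = s * Real.sin β := by rw [ht, hs]; ring
    rw [← Complex.ofReal_cos, ← Complex.ofReal_sin, ← Complex.ofReal_cos, ← Complex.ofReal_sin,
      Real.cos_sub_pi, Real.sin_sub_pi]
    have hre' := congrArg (fun x : ℝ => (x : ℂ)) hre
    have him' := congrArg (fun x : ℝ => (x : ℂ)) him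
    simp only [Complex.ofReal_sub, Complex.ofReal_mul, Complex.ofReal_neg] at hre' him' ⊢
    push_cast at hre' him' ⊢
    linear_combination hre' - Complex.I * him'
  have a1 : (1 + u).arg = α := by
    rw [h1]; exact Complex.arg_mul_cos_add_sin_mul_I htp ⟨by linarith, by linarith⟩
  have a2 : (1 - u).arg = β - Real.pi := by
    rw [h2]; exact Complex.arg_mul_cos_add_sin_mul_I hsp ⟨by linarith, by linarith⟩
  have n1 : ‖1 + u‖ = t := by
    rw [h1, norm_mul, Complex.norm_cos_add_sin_mul_I]; simp [abs_of_pos htp]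
  have n2 : ‖1 - u‖ = s := by
    rw [h2, norm_mul, Complex.norm_cos_add_sin_mul_I]; simp [abs_of_pos hsp]
  refine ⟨u, ?_, a1, ?_⟩
  · have : u.im = t * Real.sin α := by
      have := congrArg Complex.im h1
      simpa [Complex.sin_ofReal_re] using this
    rw [this]; positivity
  · have key : ρ * Real.log s + (1 - ρ) * Real.log t = ρ * Real.log r := by
      have h3 := congrArg Real.log h
      rw [Real.log_mul (by positivity) (by positivity), Real.log_mul (by positivity) (by positivity),
        Real.log_mul (by positivity) (by positivity), Real.log_rpow hsα, Real.log_rpow hsβ,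
        Real.log_rpow hr] at h3
      rw [ht, hs, Real.log_div (by positivity) (by positivity),
        Real.log_div (by positivity) (by positivity), Real.log_mul (by positivity) (by positivity),
        Real.log_mul (by positivity) (by positivity)]
      linear_combination h3
    rw [logLevel, Complex.log, Complex.log, a1, a2, n1, n2, ← key, ← hψ]
    push_cast
    ring

/-- The defect in the level equation at the point that is seen from `-1` at the angle `α` and that
has the weighted angle `ψ`. -/
def levelDefect (ρ r ψ α : ℝ) : ℝ :=
  2 * Real.sin α ^ ρ * Real.sin ((ψ - (1 - ρ) * α) / ρ) ^ (1 - ρ)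
    - r ^ ρ * Real.sin ((ψ - α) / ρ)

/-- Intermediate value theorem in α, the other angle being forced to be β = (ψ-(1-ρ)α)/ρ. The
location of arg(1+u) is recorded because it later shows where the curve ends. -/
lemma exists_point_of_levelDefect {ρ r ψ a b : ℝ} (hρ0 : 0 < ρ) (hρ1 : ρ < 1) (hr : 0 < r)
    (hψ : ψ ≤ ρ * Real.pi) (ha0 : 0 ≤ a) (hab : a ≤ b) (hbψ : b ≤ ψ)
    (ha : levelDefect ρ r ψ a < 0) (hb : 0 < levelDefect ρ r ψ b) :
    ∃ u : ℂ, 0 < u.im ∧ (1 + u).arg ∈ Set.Ioo a b ∧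
      logLevel ρ u = ((ρ * Real.log r : ℝ) : ℂ) + ((ψ - ρ * Real.pi : ℝ) : ℂ) * Complex.I := by
  have hc : ContinuousOn (levelDefect ρ r ψ) (Set.Icc a b) := by
    apply Continuous.continuousOn
    unfold levelDefect
    have c1 : Continuous fun α : ℝ => Real.sin α ^ ρ :=
      Real.continuous_sin.rpow_const fun _ => Or.inr hρ0.le
    have c2 : Continuous fun α : ℝ => Real.sin ((ψ - (1 - ρ) * α) / ρ) ^ (1 - ρ) :=
      (by fun_prop : Continuous fun α : ℝ => Real.sin ((ψ - (1 - ρ) * α) / ρ)).rpow_const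
        fun _ => Or.inr (by linarith)
    fun_prop
  obtain ⟨α, hα, hα0⟩ := intermediate_value_Ioo hab hc ⟨ha, hb⟩
  have hαpos : 0 < α := ha0.trans_lt hα.1
  have hαψ : α < ψ := hα.2.trans_le hbψ
  have e : (ψ - (1 - ρ) * α) / ρ - α = (ψ - α) / ρ := by field_simp; ring
  obtain ⟨u, hu, hua, hW⟩ := exists_point_of_angles (β := (ψ - (1 - ρ) * α) / ρ) (ρ := ρ) (ψ := ψ) hr hαpos
    (by rw [lt_div_iff₀ hρ0]; nlinarith) (by rw [div_lt_iff₀ hρ0]; nlinarith)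
    (by field_simp; ring) (by rw [e]; unfold levelDefect at hα0; linarith)
  exact ⟨u, hu, hua ▸ hα, hW⟩

lemma rCrit_pos {ρ : ℝ} (hρ0 : 0 < ρ) (hρ1 : ρ < 1) : 0 < rCrit ρ := by
  have : 0 < 1 - ρ := by linarith
  unfold rCrit; positivity

lemma rCrit_rpow {ρ : ℝ} (hρ0 : 0 < ρ) (hρ1 : ρ < 1) :
    rCrit ρ ^ ρ = 2 * ρ ^ ρ * (1 - ρ) ^ (1 - ρ) := by
  have h : 0 < 1 - ρ := by linarith
  unfold rCrit
  rw [Real.mul_rpow (by positivity) (by positivity), Real.mul_rpow (by positivity) (by positivity),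
    ← Real.rpow_mul (by positivity), ← Real.rpow_mul h.le]
  have e1 : 1 / ρ * ρ = 1 := by field_simp
  have e2 : (1 / ρ - 1) * ρ = 1 - ρ := by field_simp
  rw [e1, e2, Real.rpow_one]

lemma levelDefect_zero_neg {ρ r ψ : ℝ} (hρ0 : 0 < ρ) (hr : 0 < r) (hψ0 : 0 < ψ)
    (hψ : ψ < ρ * Real.pi) : levelDefect ρ r ψ 0 < 0 := by
  unfold levelDefect
  have : 0 < Real.sin (ψ / ρ) := Real.sin_pos_of_pos_of_lt_pi (by positivity)
    (by rw [div_lt_iff₀ hρ0]; linarith)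
  have h2 : 0 < r ^ ρ * Real.sin (ψ / ρ) := by positivity
  simp [Real.zero_rpow hρ0.ne', h2]

lemma levelDefect_self_pos {ρ r ψ : ℝ} (hρ0 : 0 < ρ) (hψ0 : 0 < ψ)
    (hψ : ψ < Real.pi) : 0 < levelDefect ρ r ψ ψ := by
  unfold levelDefect
  have : 0 < Real.sin ψ := Real.sin_pos_of_pos_of_lt_pi hψ0 hψ
  have e : (ψ - (1 - ρ) * ψ) / ρ = ψ := by field_simp; ring
  rw [e]; simp; positivity

lemma sin_pi_sub_weight {ρ α : ℝ} (hρ0 : 0 < ρ) :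
    Real.sin ((ρ * Real.pi - (1 - ρ) * α) / ρ) = Real.sin ((1 - ρ) * (α / ρ)) ∧
    Real.sin ((ρ * Real.pi - α) / ρ) = Real.sin (α / ρ) := by
  constructor
  · rw [← Real.sin_pi_sub]; congr 1; field_simp; ring
  · rw [← Real.sin_pi_sub]; congr 1; field_simp; ring

lemma mul_sin_lt_sin_mul {c x : ℝ} (hc0 : 0 < c) (hc1 : c < 1) (hx0 : 0 < x) (hx : x < Real.pi) :
    c * Real.sin x < Real.sin (c * x) := by
  have hc : (0 : ℝ) < 1 - c := by linarith
  have := strictConcaveOn_sin_Icc.2 ⟨le_rfl, Real.pi_pos.le⟩ ⟨hx0.le, hx.le⟩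
    hx0.ne hc hc0 (by ring)
  simpa using this

/-- With x = α/ρ, strict concavity gives sin(cx) > c sin x for c = ρ and c = 1-ρ. The weighted
product of these bounds is ρ^ρ (1-ρ)^(1-ρ) sin x, which is half of r_cr^ρ sin x. So for r ≤ r_cr the
level curve does not reach the weighted angle ρπ above the real axis. -/
lemma levelDefect_crit_pos {ρ r α : ℝ} (hρ0 : 0 < ρ) (hρ1 : ρ < 1) (hr : 0 < r)
    (hrc : r ≤ rCrit ρ) (hα0 : 0 < α) (hα : α < ρ * Real.pi) :
    0 < levelDefect ρ r (ρ * Real.pi) α := by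
  have h1 : 0 < 1 - ρ := by linarith
  unfold levelDefect
  rw [(sin_pi_sub_weight hρ0).1, (sin_pi_sub_weight hρ0).2]
  set x := α / ρ with hx
  have hαx : α = ρ * x := by rw [hx]; field_simp
  have hx0 : 0 < x := by positivity
  have hxπ : x < Real.pi := by rw [hx, div_lt_iff₀ hρ0]; linarith
  have hs : 0 < Real.sin x := Real.sin_pos_of_pos_of_lt_pi hx0 hxπ
  have a1 := Real.rpow_lt_rpow (by positivity) (mul_sin_lt_sin_mul hρ0 hρ1 hx0 hxπ) hρ0
  have a2 := Real.rpow_lt_rpow (by positivity)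
    (mul_sin_lt_sin_mul h1 (by linarith) hx0 hxπ) h1
  have a3 : r ^ ρ ≤ rCrit ρ ^ ρ := Real.rpow_le_rpow hr.le hrc hρ0.le
  rw [rCrit_rpow hρ0 hρ1] at a3
  rw [hαx]
  have a4 := mul_lt_mul'' a1 a2 (by positivity) (by positivity)
  have e : (ρ * Real.sin x) ^ ρ * ((1 - ρ) * Real.sin x) ^ (1 - ρ)
      = ρ ^ ρ * (1 - ρ) ^ (1 - ρ) * Real.sin x := by
    rw [Real.mul_rpow hρ0.le hs.le, Real.mul_rpow h1.le hs.le]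
    have : Real.sin x ^ ρ * Real.sin x ^ (1 - ρ) = Real.sin x := by
      rw [← Real.rpow_add hs]; simp
    linear_combination (ρ ^ ρ * (1 - ρ) ^ (1 - ρ)) * this
  rw [e] at a4
  have a5 := mul_le_mul_of_nonneg_right a3 hs.le
  nlinarith

/-- For small x = α/ρ the defect is (r_cr^ρ - r^ρ) x to first order, which is negative above the
critical radius. -/
lemma exists_levelDefect_crit_neg {ρ r : ℝ} (hρ0 : 0 < ρ) (hρ1 : ρ < 1)
    (hrc : rCrit ρ < r) : ∃ α, 0 < α ∧ α < ρ * Real.pi ∧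
      levelDefect ρ r (ρ * Real.pi) α < 0 := by
  have h1 : 0 < 1 - ρ := by linarith
  have hc := rCrit_pos hρ0 hρ1
  have hr := hc.trans hrc
  have hlt : rCrit ρ ^ ρ < r ^ ρ := Real.rpow_lt_rpow hc.le hrc hρ0
  have hrp : 0 < r ^ ρ := by positivity
  have hcp : 0 < rCrit ρ ^ ρ := by positivity
  obtain ⟨x, hx0, hx1, hx⟩ : ∃ x : ℝ, 0 < x ∧ x ≤ 1 ∧ rCrit ρ ^ ρ * x < r ^ ρ * Real.sin x := by
    -- The relative gap d serves as x: then r_cr^ρ = r^ρ (1-d), and the loss d² beats the cubic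
    -- error of the sine.
    set d := (r ^ ρ - rCrit ρ ^ ρ) / r ^ ρ with hd
    have hd0 : 0 < d := div_pos (by linarith) hrp
    have hd1 : d ≤ 1 := by rw [hd, div_le_one hrp]; linarith
    refine ⟨d, hd0, hd1, ?_⟩
    have hs := Real.sin_gt_sub_cube hd0
    have e : rCrit ρ ^ ρ = r ^ ρ * (1 - d) := by rw [hd]; field_simp; ring
    rw [e, mul_assoc]
    apply mul_lt_mul_of_pos_left _ hrp
    nlinarith [mul_pos hd0 hd0]
  have hxπ : x < Real.pi := by linarith [Real.pi_gt_three]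
  refine ⟨ρ * x, by positivity, by gcongr, ?_⟩
  unfold levelDefect
  rw [(sin_pi_sub_weight hρ0).1, (sin_pi_sub_weight hρ0).2]
  have ex : ρ * x / ρ = x := by field_simp
  rw [ex]
  have b1 : Real.sin (ρ * x) ^ ρ ≤ (ρ * x) ^ ρ :=
    Real.rpow_le_rpow (Real.sin_nonneg_of_nonneg_of_le_pi (by positivity) (by nlinarith))
      (Real.sin_le (by positivity)) hρ0.le
  have b2 : Real.sin ((1 - ρ) * x) ^ (1 - ρ) ≤ ((1 - ρ) * x) ^ (1 - ρ) :=
    Real.rpow_le_rpow (Real.sin_nonneg_of_nonneg_of_le_pi (by positivity) (by nlinarith))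
      (Real.sin_le (by positivity)) h1.le
  have b3 := mul_le_mul b1 b2 (Real.rpow_nonneg
    (Real.sin_nonneg_of_nonneg_of_le_pi (by positivity) (by nlinarith)) _) (by positivity)
  have e : (ρ * x) ^ ρ * ((1 - ρ) * x) ^ (1 - ρ) = ρ ^ ρ * (1 - ρ) ^ (1 - ρ) * x := by
    rw [Real.mul_rpow hρ0.le hx0.le, Real.mul_rpow h1.le hx0.le]
    have : x ^ ρ * x ^ (1 - ρ) = x := by
      rw [← Real.rpow_add hx0]; simp
    linear_combination (ρ ^ ρ * (1 - ρ) ^ (1 - ρ)) * this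
  rw [e] at b3
  rw [rCrit_rpow hρ0 hρ1] at hx
  linarith

/-! ### The level curve, its derivative, and monotonicity along it -/

/-- The value of `logLevel` at the point of the level curve of radius `r` with weighted angle `ψ`. -/
def levelValue (ρ r ψ : ℝ) : ℂ :=
  ((ρ * Real.log r : ℝ) : ℂ) + ((ψ - ρ * Real.pi : ℝ) : ℂ) * Complex.I

/-- The point of the upper half plane on the level curve of radius `r` with weighted angle `ψ`. -/
def levelPoint (ρ r ψ : ℝ) : ℂ :=
  Classical.epsilon fun u : ℂ => 0 < u.im ∧ logLevel ρ u = levelValue ρ r ψ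

lemma levelPoint_spec {ρ r ψ : ℝ} (hρ0 : 0 < ρ) (hρ1 : ρ < 1) (hr : 0 < r) (hψ0 : 0 < ψ)
    (hψ : ψ < ρ * Real.pi) :
    0 < (levelPoint ρ r ψ).im ∧ logLevel ρ (levelPoint ρ r ψ) = levelValue ρ r ψ := by
  obtain ⟨u, hu, -, hW⟩ := exists_point_of_levelDefect hρ0 hρ1 hr hψ.le le_rfl hψ0.le le_rfl
    (levelDefect_zero_neg hρ0 hr hψ0 hψ)
    (levelDefect_self_pos hρ0 hψ0 (by nlinarith [Real.pi_pos]))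
  exact Classical.epsilon_spec (p := fun u : ℂ => 0 < u.im ∧ logLevel ρ u = levelValue ρ r ψ)
    ⟨u, hu, hW⟩

lemma eq_levelPoint {ρ r ψ : ℝ} (hρ0 : 0 < ρ) (hρ1 : ρ < 1) {u : ℂ} (hu : 0 < u.im)
    (h : logLevel ρ u = levelValue ρ r ψ) : u = levelPoint ρ r ψ := by
  have := Classical.epsilon_spec
    (p := fun u : ℂ => 0 < u.im ∧ logLevel ρ u = levelValue ρ r ψ) ⟨u, hu, h⟩
  exact logLevel_injOn hρ0 hρ1 hu this.1 (h.trans this.2.symm)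

lemma logLevel_re (ρ : ℝ) (u : ℂ) :
    (logLevel ρ u).re = ρ * Real.log ‖1 - u‖ + (1 - ρ) * Real.log ‖1 + u‖ := by
  have e : logLevel ρ u = (ρ : ℂ) * Complex.log (1 - u) + ((1 - ρ : ℝ) : ℂ) * Complex.log (1 + u) := by
    simp [logLevel]
  rw [e, Complex.add_re, Complex.re_ofReal_mul, Complex.re_ofReal_mul, Complex.log_re,
    Complex.log_re]

lemma logLevel_im (ρ : ℝ) (u : ℂ) :
    (logLevel ρ u).im = ρ * (1 - u).arg + (1 - ρ) * (1 + u).arg := by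
  have e : logLevel ρ u = (ρ : ℂ) * Complex.log (1 - u) + ((1 - ρ : ℝ) : ℂ) * Complex.log (1 + u) := by
    simp [logLevel]
  rw [e, Complex.add_im, Complex.im_ofReal_mul, Complex.im_ofReal_mul, Complex.log_im,
    Complex.log_im]

lemma levelValue_re (ρ r ψ : ℝ) : (levelValue ρ r ψ).re = ρ * Real.log r := by
  simp [levelValue]

lemma levelValue_im (ρ r ψ : ℝ) : (levelValue ρ r ψ).im = ψ - ρ * Real.pi := by
  simp [levelValue]

/-- Near a point of the level curve, the curve is given by `levelPoint`. -/
lemma tendsto_levelPoint {ρ r ψ : ℝ} (hρ0 : 0 < ρ) (hρ1 : ρ < 1) {u : ℂ} (hu : 0 < u.im)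
    (h : logLevel ρ u = levelValue ρ r ψ) :
    Tendsto (levelPoint ρ r) (𝓝 ψ) (𝓝 u) := by
  intro s hs
  have hs' : s ∩ {u : ℂ | 0 < u.im} ∈ 𝓝 u :=
    inter_mem hs ((isOpen_lt continuous_const Complex.continuous_im).mem_nhds hu)
  -- W is open at u, so nearby values are taken at nearby points, and injectivity identifies these
  -- with `levelPoint`. The angle ψ = ρπ is not excluded; the limit at u_* uses it.
  have hmap := (hasStrictDerivAt_logLevel ρ hu).map_nhds_eq (logLevelDeriv_ne_zero hρ0 hρ1 hu)
  have himg : logLevel ρ '' (s ∩ {u : ℂ | 0 < u.im}) ∈ 𝓝 (levelValue ρ r ψ) := by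
    rw [← h, ← hmap]; exact image_mem_map hs'
  have hc : Continuous (levelValue ρ r) := by unfold levelValue; fun_prop
  have hpre : ∀ᶠ x in 𝓝 ψ, levelValue ρ r x ∈ logLevel ρ '' (s ∩ {u : ℂ | 0 < u.im}) :=
    hc.continuousAt himg
  change ∀ᶠ x in 𝓝 ψ, levelPoint ρ r x ∈ s
  filter_upwards [hpre] with ψ' hψ'
  obtain ⟨v, hv, hv'⟩ := hψ'
  have := eq_levelPoint hρ0 hρ1 hv.2 hv'
  exact this ▸ hv.1

lemma hasDerivAt_levelPoint {ρ r ψ : ℝ} (hρ0 : 0 < ρ) (hρ1 : ρ < 1) (hr : 0 < r) (hψ0 : 0 < ψ)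
    (hψ : ψ < ρ * Real.pi) :
    HasDerivAt (levelPoint ρ r) (Complex.I / logLevelDeriv ρ (levelPoint ρ r ψ)) ψ := by
  obtain ⟨hu, hW⟩ := levelPoint_spec hρ0 hρ1 hr hψ0 hψ
  set u := levelPoint ρ r ψ with hu'
  have hs := hasStrictDerivAt_logLevel ρ hu
  have hne := logLevelDeriv_ne_zero hρ0 hρ1 hu
  have hinv := hs.to_localInverse hne
  rw [hW] at hinv
  have hval : HasDerivAt (levelValue ρ r) Complex.I ψ := by
    have h1 : HasDerivAt (fun ψ : ℝ => ((ψ - ρ * Real.pi : ℝ) : ℂ)) 1 ψ := by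
      simpa using ((hasDerivAt_id ψ).sub_const (ρ * Real.pi)).ofReal_comp
    have h2 := (h1.mul_const Complex.I).const_add ((ρ * Real.log r : ℝ) : ℂ)
    rw [one_mul] at h2
    exact h2
  have hcomp := hinv.hasDerivAt.comp ψ hval
  have hgoal := hcomp.congr_of_eventuallyEq (f₁ := levelPoint ρ r) ?_
  · refine hgoal.congr_deriv ?_
    field_simp
  · have ht := tendsto_levelPoint hρ0 hρ1 hu hW
    have hleft := hs.eventually_left_inverse hne
    filter_upwards [ht.eventually hleft, (isOpen_Ioo (a := (0:ℝ)) (b := ρ * Real.pi)).mem_nhds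
      ⟨hψ0, hψ⟩] with x hx hx'
    simp only [Function.comp]
    rw [← (levelPoint_spec hρ0 hρ1 hr hx'.1 hx'.2).2]
    exact hx.symm

/-- The derivative of a holomorphic function along the level curve. -/
lemma hasDerivAt_comp_levelPoint {ρ r ψ : ℝ} (hρ0 : 0 < ρ) (hρ1 : ρ < 1) (hr : 0 < r)
    (hψ0 : 0 < ψ) (hψ : ψ < ρ * Real.pi) {A : ℂ → ℂ} {h : ℂ}
    (hA : HasDerivAt A (h * logLevelDeriv ρ (levelPoint ρ r ψ)) (levelPoint ρ r ψ)) :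
    HasDerivAt (fun ψ => A (levelPoint ρ r ψ)) (h * Complex.I) ψ := by
  have hne := logLevelDeriv_ne_zero hρ0 hρ1 (levelPoint_spec hρ0 hρ1 hr hψ0 hψ).1
  have h1 := hA.comp ψ (hasDerivAt_levelPoint hρ0 hρ1 hr hψ0 hψ)
  refine h1.congr_deriv ?_
  field_simp

/-- This turns Riemann sums of Re f along the curve into differences of Im A. -/
lemma hasDerivAt_im_comp_levelPoint {ρ r ψ : ℝ} (hρ0 : 0 < ρ) (hρ1 : ρ < 1) (hr : 0 < r)
    (hψ0 : 0 < ψ) (hψ : ψ < ρ * Real.pi) {A : ℂ → ℂ} {h : ℂ}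
    (hA : HasDerivAt A (h * logLevelDeriv ρ (levelPoint ρ r ψ)) (levelPoint ρ r ψ)) :
    HasDerivAt (fun ψ => (A (levelPoint ρ r ψ)).im) h.re ψ := by
  have h2 := Complex.imCLM.hasFDerivAt.comp_hasDerivAt ψ
    (hasDerivAt_comp_levelPoint hρ0 hρ1 hr hψ0 hψ hA)
  simpa [Function.comp_def] using h2

/-- If `A' X = logLevel'` with `Im X < 0`, then `Re A` decreases along the level curve. -/
lemma antitoneOn_re_comp_levelPoint {ρ r : ℝ} (hρ0 : 0 < ρ) (hρ1 : ρ < 1) (hr : 0 < r)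
    {A X : ℂ → ℂ} (hX : ∀ u : ℂ, 0 < u.im → (X u).im < 0)
    (hA : ∀ u : ℂ, 0 < u.im → HasDerivAt A ((X u)⁻¹ * logLevelDeriv ρ u) u) :
    AntitoneOn (fun ψ => (A (levelPoint ρ r ψ)).re) (Set.Ioo 0 (ρ * Real.pi)) := by
  have hd : ∀ ψ ∈ Set.Ioo 0 (ρ * Real.pi), HasDerivAt (fun ψ => (A (levelPoint ρ r ψ)).re)
      ((X (levelPoint ρ r ψ)).im / Complex.normSq (X (levelPoint ρ r ψ))) ψ := by
    intro ψ hψ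
    have hu := (levelPoint_spec hρ0 hρ1 hr hψ.1 hψ.2).1
    have h2 := Complex.reCLM.hasFDerivAt.comp_hasDerivAt ψ
      (hasDerivAt_comp_levelPoint hρ0 hρ1 hr hψ.1 hψ.2 (hA _ hu))
    refine HasDerivAt.congr_deriv h2 ?_
    simp [Complex.inv_im, neg_div]
  apply antitoneOn_of_deriv_nonpos (convex_Ioo _ _)
  · exact fun ψ hψ => (hd ψ hψ).continuousAt.continuousWithinAt
  · rw [interior_Ioo]
    exact fun ψ hψ => (hd ψ hψ).differentiableAt.differentiableWithinAt
  · rw [interior_Ioo]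
    intro ψ hψ
    rw [(hd ψ hψ).deriv]
    have hu := (levelPoint_spec hρ0 hρ1 hr hψ.1 hψ.2).1
    exact div_nonpos_of_nonpos_of_nonneg (hX _ hu).le (Complex.normSq_nonneg _)

lemma antitoneOn_re_levelPoint {ρ r : ℝ} (hρ0 : 0 < ρ) (hρ1 : ρ < 1) (hr : 0 < r) :
    AntitoneOn (fun ψ => (levelPoint ρ r ψ).re) (Set.Ioo 0 (ρ * Real.pi)) := by
  refine antitoneOn_re_comp_levelPoint (A := fun u => u) (X := logLevelDeriv ρ) hρ0 hρ1 hr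
    (fun u hu => logLevelDeriv_im_neg hρ0 hρ1 hu) fun u hu => ?_
  rw [inv_mul_cancel₀ (logLevelDeriv_ne_zero hρ0 hρ1 hu)]
  exact hasDerivAt_id u

/-- Here X = (1+u) W' simplifies to 1 - 2ρ/(1-u), whose imaginary part is visibly negative. -/
lemma antitoneOn_re_log_levelPoint {ρ r : ℝ} (hρ0 : 0 < ρ) (hρ1 : ρ < 1) (hr : 0 < r) :
    AntitoneOn (fun ψ => (Complex.log (1 + levelPoint ρ r ψ)).re) (Set.Ioo 0 (ρ * Real.pi)) := by
  refine antitoneOn_re_comp_levelPoint (A := fun u => Complex.log (1 + u))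
    (X := fun u => (1 + u) * logLevelDeriv ρ u) hρ0 hρ1 hr (fun u hu => ?_) fun u hu => ?_
  · have h1 := one_sub_ne_zero_of_im_pos hu
    have h2 := one_add_ne_zero_of_im_pos hu
    have e : (1 + u) * logLevelDeriv ρ u = ((-2 * ρ : ℝ) : ℂ) * (1 - u)⁻¹ + ((1 : ℝ) : ℂ) := by
      unfold logLevelDeriv; push_cast; field_simp; ring
    rw [e, Complex.add_im, Complex.im_ofReal_mul, Complex.ofReal_im]
    have := im_inv_one_sub_pos hu
    nlinarith
  · have h1 := logLevelDeriv_ne_zero hρ0 hρ1 hu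
    refine (hasStrictDerivAt_log_one_add hu).hasDerivAt.congr_deriv ?_
    rw [mul_inv, mul_assoc, inv_mul_cancel₀ h1, mul_one]

/-! ### Bounds that are uniform in the radius -/

lemma arg_one_add_pos {u : ℂ} (hu : 0 < u.im) : 0 < (1 + u).arg := by
  have h0 : 0 ≤ (1 + u).arg := Complex.arg_nonneg_iff.2 (by simpa using hu.le)
  refine lt_of_le_of_ne h0 fun h => ?_
  have := (Complex.arg_eq_zero_iff.1 h.symm).2
  simp at this; exact hu.ne' this

lemma arg_one_sub_neg {u : ℂ} (hu : 0 < u.im) : (1 - u).arg < 0 :=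
  Complex.arg_neg_iff.2 (by simpa using hu)

/-- If |u| > 1+R, both |1-u| and |1+u| exceed R, so the weighted mean of their logarithms exceeds
log R. Since R ≥ 1, this is at least ρ log r. -/
lemma norm_le_of_logLevel_re {ρ r R : ℝ} (hρ0 : 0 < ρ) (hρ1 : ρ < 1) (hr : 0 < r) (hrR : r ≤ R)
    (hR : 1 ≤ R) {u : ℂ} (h : (logLevel ρ u).re = ρ * Real.log r) : ‖u‖ ≤ 1 + R := by
  by_contra! hlt
  rw [logLevel_re] at h
  have h1 : ‖u‖ - 1 ≤ ‖1 - u‖ := by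
    rw [norm_sub_rev]; simpa using norm_sub_norm_le u 1
  have h2 : ‖u‖ - 1 ≤ ‖1 + u‖ := by
    have := norm_sub_norm_le u (-1)
    rw [sub_neg_eq_add, add_comm u] at this; simpa using this
  have hx : 0 < ‖u‖ - 1 := by linarith
  have l1 := Real.log_le_log hx h1
  have l2 := Real.log_le_log hx h2
  have l3 : Real.log R < Real.log (‖u‖ - 1) := Real.log_lt_log (by linarith) (by linarith)
  have l4 := Real.log_le_log hr hrR
  have l5 := Real.log_nonneg hR
  have l6 : Real.log (‖u‖ - 1) ≤ ρ * Real.log r := by nlinarith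
  nlinarith

/-- The lower bound for `|1+u|` on the part of the upper half plane where the weighted angle is at
most `ρπ`. -/
def distBound (ρ : ℝ) : ℝ := min 1 (2 * (1 - ρ) / (ρ * Real.pi))

lemma distBound_pos {ρ : ℝ} (hρ0 : 0 < ρ) (hρ1 : ρ < 1) : 0 < distBound ρ := by
  have := Real.pi_pos
  have h1 : 0 < 1 - ρ := by linarith
  unfold distBound; positivity

/-- Near -1 the angle γ seen from 1 is small: by Jordan's inequality 2γ/π ≤ Im u ≤ α|1+u|, with α =
arg(1+u). But Im W ≤ 0 means (1-ρ)α ≤ ργ. Together they bound |1+u| below by the constant in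
`distBound`. -/
lemma distBound_le_norm {ρ : ℝ} (hρ0 : 0 < ρ) {u : ℂ} (hu : 0 < u.im)
    (h : (logLevel ρ u).im ≤ 0) : distBound ρ ≤ ‖1 + u‖ := by
  by_contra! hlt
  obtain ⟨hlt1, hlt2⟩ := lt_min_iff.1 hlt
  rw [logLevel_im] at h
  have hpi := Real.pi_pos
  have hα := arg_one_add_pos hu
  have hn1 : 0 < ‖1 + u‖ := norm_pos_iff.2 (one_add_ne_zero_of_im_pos hu)
  have hre : 0 < (1 - u).re := by
    have := Complex.abs_re_le_norm (1 + u)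
    simp only [Complex.add_re, Complex.one_re, Complex.sub_re] at this ⊢
    linarith [le_abs_self (1 + u.re)]
  have hn2 : 1 ≤ ‖1 - u‖ := by
    have := norm_sub_norm_le (2 : ℂ) (1 + u)
    have e : (2 : ℂ) - (1 + u) = 1 - u := by ring
    rw [e] at this; simp at this; linarith
  set γ := -(1 - u).arg with hγ
  have hγ0 : 0 < γ := by have := arg_one_sub_neg hu; linarith
  have hγ1 : γ ≤ Real.pi / 2 := by
    have := (Complex.abs_arg_le_pi_div_two_iff (z := 1 - u)).2 hre.le
    have := neg_abs_le (1 - u).arg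
    linarith
  have hsγ : Real.sin γ = u.im / ‖1 - u‖ := by
    rw [hγ, Real.sin_neg, Complex.sin_arg]; simp [neg_div]
  have hsα : Real.sin (1 + u).arg = u.im / ‖1 + u‖ := by
    rw [Complex.sin_arg]; simp
  have k1 : 2 / Real.pi * γ ≤ Real.sin γ := Real.mul_le_sin hγ0.le hγ1
  have k2 : Real.sin γ ≤ u.im := by rw [hsγ]; exact div_le_self hu.le hn2
  have k3 : u.im ≤ (1 + u).arg * ‖1 + u‖ := by
    have := Real.sin_le hα.le
    rw [hsα, div_le_iff₀ hn1] at this; exact this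
  have k4 : (1 - ρ) * (1 + u).arg ≤ ρ * γ := by rw [hγ]; linarith
  have k5 : 2 * γ ≤ Real.pi * ((1 + u).arg * ‖1 + u‖) := by
    have : 2 / Real.pi * γ ≤ (1 + u).arg * ‖1 + u‖ := by linarith
    rw [div_mul_eq_mul_div, div_le_iff₀ hpi] at this; linarith
  rw [lt_div_iff₀ (by positivity)] at hlt2
  have k6 : ρ * (2 * γ) ≤ ρ * (Real.pi * ((1 + u).arg * ‖1 + u‖)) := by gcongr
  have k7 := mul_lt_mul_of_pos_left hlt2 hα
  nlinarith

/-! ### The two ends of the level curve -/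

lemma arg_one_add_lt {ρ r ψ : ℝ} (hρ0 : 0 < ρ) {u : ℂ}
    (h : logLevel ρ u = levelValue ρ r ψ) : (1 - ρ) * (1 + u).arg < ψ := by
  have h1 := congrArg Complex.im h
  rw [logLevel_im, levelValue_im] at h1
  have := Complex.neg_pi_lt_arg (1 - u)
  nlinarith

lemma tendsto_arg_levelPoint_zero {ρ r : ℝ} (hρ0 : 0 < ρ) (hρ1 : ρ < 1) (hr : 0 < r) :
    Tendsto (fun ψ => (1 + levelPoint ρ r ψ).arg) (𝓝[>] 0) (𝓝 0) := by
  have h1 : 0 < 1 - ρ := by linarith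
  have hev : ∀ᶠ ψ in 𝓝[>] (0 : ℝ), ψ ∈ Set.Ioo 0 (ρ * Real.pi) :=
    Ioo_mem_nhdsGT (by have := Real.pi_pos; positivity)
  have hlim : Tendsto (fun ψ : ℝ => ψ / (1 - ρ)) (𝓝[>] 0) (𝓝 0) := by
    have : Tendsto (fun ψ : ℝ => ψ / (1 - ρ)) (𝓝 0) (𝓝 (0 / (1 - ρ))) :=
      tendsto_id.div_const _
    rw [zero_div] at this
    exact this.mono_left nhdsWithin_le_nhds
  refine tendsto_of_tendsto_of_tendsto_of_le_of_le' tendsto_const_nhds hlim ?_ ?_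
  · filter_upwards [hev] with ψ hψ
    exact (arg_one_add_pos (levelPoint_spec hρ0 hρ1 hr hψ.1 hψ.2).1).le
  · filter_upwards [hev] with ψ hψ
    rw [le_div_iff₀ h1, mul_comm]
    exact (arg_one_add_lt hρ0 (levelPoint_spec hρ0 hρ1 hr hψ.1 hψ.2).2).le

/-- At a fixed small angle b the defect is positive for ψ = ρπ, hence for ψ nearby. The intermediate
value theorem on (0,b) then produces a point of the curve, which by uniqueness is `levelPoint ρ r
ψ`. -/
lemma tendsto_arg_levelPoint_crit {ρ r : ℝ} (hρ0 : 0 < ρ) (hρ1 : ρ < 1) (hr : 0 < r)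
    (hrc : r ≤ rCrit ρ) :
    Tendsto (fun ψ => (1 + levelPoint ρ r ψ).arg) (𝓝[<] (ρ * Real.pi)) (𝓝 0) := by
  have hπ : 0 < ρ * Real.pi := by have := Real.pi_pos; positivity
  have hev : ∀ᶠ ψ in 𝓝[<] (ρ * Real.pi), ψ ∈ Set.Ioo 0 (ρ * Real.pi) := Ioo_mem_nhdsLT hπ
  have hpos : ∀ᶠ ψ in 𝓝[<] (ρ * Real.pi), 0 < (1 + levelPoint ρ r ψ).arg := by
    filter_upwards [hev] with ψ hψ
    exact arg_one_add_pos (levelPoint_spec hρ0 hρ1 hr hψ.1 hψ.2).1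
  rw [tendsto_order]
  refine ⟨fun a ha => hpos.mono fun ψ h => ha.trans h, fun a ha => ?_⟩
  set b := min a (ρ * Real.pi / 2) with hb
  have hb0 : 0 < b := by positivity
  have hbπ : b < ρ * Real.pi := (min_le_right _ _).trans_lt (by linarith)
  have hcont : Continuous fun ψ => levelDefect ρ r ψ b := by
    unfold levelDefect
    have c2 : Continuous fun ψ : ℝ => Real.sin ((ψ - (1 - ρ) * b) / ρ) ^ (1 - ρ) :=
      (by fun_prop : Continuous fun ψ : ℝ => Real.sin ((ψ - (1 - ρ) * b) / ρ)).rpow_const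
        fun _ => Or.inr (by linarith)
    fun_prop
  have hdef : ∀ᶠ ψ in 𝓝[<] (ρ * Real.pi), 0 < levelDefect ρ r ψ b :=
    ((hcont.tendsto _).mono_left nhdsWithin_le_nhds).eventually
      (lt_mem_nhds (levelDefect_crit_pos hρ0 hρ1 hr hrc hb0 hbπ))
  have hgt : ∀ᶠ ψ in 𝓝[<] (ρ * Real.pi), b < ψ := by
    filter_upwards [Ioo_mem_nhdsLT hbπ] with ψ h using h.1
  filter_upwards [hev, hdef, hgt] with ψ hψ hd hbψ
  obtain ⟨u, hu, hua, hW⟩ := exists_point_of_levelDefect hρ0 hρ1 hr hψ.2.le le_rfl hb0.le hbψ.le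
    (levelDefect_zero_neg hρ0 hr hψ.1 hψ.2) hd
  rw [← eq_levelPoint hρ0 hρ1 hu hW]
  exact hua.2.trans_le (min_le_left _ _)

/-- Existence of `u_*(r)` for `r > r_cr`. -/
lemma isUStar_uStar {ρ r : ℝ} (hρ0 : 0 < ρ) (hρ1 : ρ < 1) (hrc : rCrit ρ < r) :
    IsUStar ρ r (uStar ρ r) := by
  have hr := (rCrit_pos hρ0 hρ1).trans hrc
  have hπ := Real.pi_pos
  -- At ψ = ρπ the defect vanishes at α = 0, so the lower end of the interval has to move to an
  -- angle where it is negative.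
  obtain ⟨a, ha0, haπ, ha⟩ := exists_levelDefect_crit_neg hρ0 hρ1 hrc
  obtain ⟨u, hu, -, hW⟩ := exists_point_of_levelDefect hρ0 hρ1 hr le_rfl ha0.le haπ.le le_rfl
    ha (levelDefect_self_pos hρ0 (by positivity) (by nlinarith))
  rw [uStar, if_neg hrc.ne']
  apply Classical.epsilon_spec (p := IsUStar ρ r)
  refine ⟨u, ?_, ?_, hu⟩
  · rw [Complex.cpow_def_of_ne_zero (one_sub_ne_zero_of_im_pos hu),
      Complex.cpow_def_of_ne_zero (one_add_ne_zero_of_im_pos hu), ← Complex.exp_add]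
    have e : Complex.log (1 - u) * ρ + Complex.log (1 + u) * ((1 - ρ : ℝ) : ℂ)
        = ((Real.log r * ρ : ℝ) : ℂ) := by
      rw [logLevel] at hW
      simp only [sub_self, Complex.ofReal_zero, zero_mul, add_zero] at hW
      push_cast at hW ⊢
      linear_combination hW
    rw [e, Real.rpow_def_of_pos hr, Complex.ofReal_exp]
  · have := congrArg Complex.im hW
    rw [logLevel_im] at this
    simpa using this

/-- The modulus of the power equation gives the real part and the argument condition gives the
imaginary part without a 2π ambiguity. So u_* is the point at ψ = ρπ of the same curve. -/
lemma logLevel_uStar {ρ r : ℝ} (hρ0 : 0 < ρ) (hρ1 : ρ < 1) (hrc : rCrit ρ < r) :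
    0 < (uStar ρ r).im ∧ logLevel ρ (uStar ρ r) = levelValue ρ r (ρ * Real.pi) := by
  obtain ⟨h1, h2, hu⟩ := isUStar_uStar hρ0 hρ1 hrc
  have hr := (rCrit_pos hρ0 hρ1).trans hrc
  refine ⟨hu, ?_⟩
  have hn1 := norm_pos_iff.2 (one_sub_ne_zero_of_im_pos hu)
  have hn2 := norm_pos_iff.2 (one_add_ne_zero_of_im_pos hu)
  apply Complex.ext
  · have h3 := congrArg (fun z : ℂ => Real.log ‖z‖) h1
    simp only [norm_mul, Complex.norm_real] at h3
    rw [Complex.norm_cpow_real, Complex.norm_cpow_real, Real.norm_of_nonneg (by positivity),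
      Real.log_mul (by positivity) (by positivity), Real.log_rpow hn1, Real.log_rpow hn2,
      Real.log_rpow hr] at h3
    rw [logLevel_re, levelValue_re, h3]
  · rw [logLevel_im, levelValue_im, h2, sub_self]

lemma tendsto_levelPoint_uStar {ρ r : ℝ} (hρ0 : 0 < ρ) (hρ1 : ρ < 1) (hrc : rCrit ρ < r) :
    Tendsto (levelPoint ρ r) (𝓝[<] (ρ * Real.pi)) (𝓝 (uStar ρ r)) :=
  (tendsto_levelPoint hρ0 hρ1 (logLevel_uStar hρ0 hρ1 hrc).1
    (logLevel_uStar hρ0 hρ1 hrc).2).mono_left nhdsWithin_le_nhds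

/-! ### The dilogarithm off the real axis -/

/-- The left side is the distance from 1 to the real line spanned by z. -/
lemma abs_im_div_norm_le {z : ℂ} (hz : z.im ≠ 0) (t : ℝ) : |z.im| / ‖z‖ ≤ ‖1 - t * z‖ := by
  have hz0 : z ≠ 0 := fun h => hz (by simp [h])
  rw [div_le_iff₀ (norm_pos_iff.2 hz0)]
  have e : ‖1 - t * z‖ * ‖z‖ = ‖(1 - t * z) * (starRingEnd ℂ) z‖ := by
    rw [norm_mul, Complex.norm_conj]
  rw [e]
  have h2 := Complex.abs_im_le_norm ((1 - t * z) * (starRingEnd ℂ) z)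
  have e2 : ((1 - t * z) * (starRingEnd ℂ) z).im = -z.im := by
    simp; ring
  rwa [e2, abs_neg] at h2

lemma one_sub_mul_mem_slitPlane {z : ℂ} (hz : z.im ≠ 0) (t : ℝ) :
    1 - t * z ∈ Complex.slitPlane := by
  rcases eq_or_ne t 0 with h | h
  · simp [h]
  · right; simp [h, hz]

lemma hasDerivAt_log_one_sub_mul {z : ℂ} (hz : z.im ≠ 0) (t : ℝ) :
    HasDerivAt (fun t : ℝ => Complex.log (1 - t * z)) (-z / (1 - t * z)) t := by
  have h1 : HasDerivAt (fun t : ℝ => 1 - (t : ℂ) * z) (-z) t := by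
    simpa using ((Complex.ofRealCLM.hasDerivAt (x := t)).mul_const z).const_sub 1
  exact h1.clog_real (one_sub_mul_mem_slitPlane hz t)

lemma norm_log_one_sub_mul_le {z : ℂ} (hz : z.im ≠ 0) {t : ℝ} (ht : 0 ≤ t) :
    ‖Complex.log (1 - t * z)‖ ≤ ‖z‖ * (‖z‖ / |z.im|) * t := by
  have hz0 : z ≠ 0 := fun h => hz (by simp [h])
  have hn := norm_pos_iff.2 hz0
  have him := abs_pos.2 hz
  have := Convex.norm_image_sub_le_of_norm_hasDerivWithin_le (𝕜 := ℝ) (s := Set.univ)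
    (f := fun t : ℝ => Complex.log (1 - t * z)) (f' := fun t => -z / (1 - t * z))
    (C := ‖z‖ * (‖z‖ / |z.im|)) (x := 0) (y := t)
    (fun x _ => (hasDerivAt_log_one_sub_mul hz x).hasDerivWithinAt) (fun x _ => ?_)
    convex_univ (Set.mem_univ _) (Set.mem_univ _)
  · simpa [abs_of_nonneg ht] using this
  · rw [norm_div, norm_neg, div_eq_mul_inv]
    gcongr
    rw [← inv_div]
    exact inv_anti₀ (by positivity) (abs_im_div_norm_le hz x)

lemma intervalIntegrable_dilog {z : ℂ} (hz : z.im ≠ 0) :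
    IntervalIntegrable (fun t : ℝ => Complex.log (1 - t * z) / t) MeasureTheory.volume 0 1 := by
  refine (intervalIntegrable_const (c := ‖z‖ * (‖z‖ / |z.im|))).mono_fun ?_ ?_
  · apply Measurable.aestronglyMeasurable
    fun_prop
  · refine MeasureTheory.ae_restrict_of_forall_mem measurableSet_uIoc fun t ht => ?_
    rw [Set.uIoc_of_le zero_le_one] at ht
    change ‖Complex.log (1 - t * z) / t‖ ≤ ‖‖z‖ * (‖z‖ / |z.im|)‖
    rw [norm_div, Complex.norm_real, Real.norm_of_nonneg ht.1.le, div_le_iff₀ ht.1]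
    exact (norm_log_one_sub_mul_le hz ht.1.le).trans
      (mul_le_mul_of_nonneg_right (le_abs_self _) ht.1.le)

lemma integral_neg_inv_one_sub_mul {z : ℂ} (hz : z.im ≠ 0) :
    ∫ t in (0 : ℝ)..1, -(1 - t * z)⁻¹ = Complex.log (1 - z) / z := by
  have hz0 : z ≠ 0 := fun h => hz (by simp [h])
  have hne : ∀ t : ℝ, 1 - t * z ≠ 0 := fun t =>
    Complex.slitPlane_ne_zero (one_sub_mul_mem_slitPlane hz t)
  have hc : Continuous fun t : ℝ => -(1 - (t : ℂ) * z)⁻¹ :=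
    ((by fun_prop : Continuous fun t : ℝ => 1 - (t : ℂ) * z).inv₀ hne).neg
  rw [intervalIntegral.integral_eq_sub_of_hasDerivAt
    (f := fun t : ℝ => Complex.log (1 - t * z) / z) (fun t _ => ?_) (hc.intervalIntegrable _ _)]
  · simp
  · refine ((hasDerivAt_log_one_sub_mul hz t).div_const z).congr_deriv ?_
    have := hne t
    field_simp

lemma hasDerivAt_dilog {z : ℂ} (hz : z.im ≠ 0) :
    HasDerivAt dilog (-(Complex.log (1 - z) / z)) z := by
  have hz0 : z ≠ 0 := fun h => hz (by simp [h])
  have hn := norm_pos_iff.2 hz0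
  have him := abs_pos.2 hz
  -- On this ball |Im w|/|w| is bounded below, which gives a constant bound for the differentiated
  -- integrand.
  have hball : ∀ w ∈ Metric.ball z (|z.im| / 2), |z.im| / 2 ≤ |w.im| ∧ ‖w‖ ≤ 2 * ‖z‖ := by
    intro w hw
    rw [Metric.mem_ball, dist_eq_norm] at hw
    have h1 := Complex.abs_im_le_norm (w - z)
    have h2 := Complex.abs_im_le_norm z
    rw [Complex.sub_im] at h1
    have h3 := abs_sub_abs_le_abs_sub z.im w.im
    rw [abs_sub_comm] at h3
    have h4 := norm_le_norm_add_norm_sub' w z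
    constructor <;> linarith
  have key := intervalIntegral.hasDerivAt_integral_of_dominated_loc_of_deriv_le
    (μ := MeasureTheory.volume) (a := (0 : ℝ)) (b := 1) (x₀ := z)
    (s := Metric.ball z (|z.im| / 2)) (bound := fun _ => (|z.im| / 2 / (2 * ‖z‖))⁻¹)
    (F := fun (w : ℂ) (t : ℝ) => Complex.log (1 - t * w) / t)
    (F' := fun (w : ℂ) (t : ℝ) => -(1 - t * w)⁻¹)
    (Metric.ball_mem_nhds z (by positivity)) ?_ (intervalIntegrable_dilog hz) ?_ ?_ ?_ ?_
  · have h2 := key.2.neg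
    rw [integral_neg_inv_one_sub_mul hz] at h2
    exact h2
  · filter_upwards with w
    apply Measurable.aestronglyMeasurable
    fun_prop
  · apply Measurable.aestronglyMeasurable
    fun_prop
  · filter_upwards with t ht w hw
    obtain ⟨h1, h2⟩ := hball w hw
    have hwim : w.im ≠ 0 := by
      intro h; rw [h, abs_zero] at h1; linarith
    have hw0 : w ≠ 0 := fun h => hwim (by simp [h])
    have hwn := norm_pos_iff.2 hw0
    rw [norm_neg, norm_inv]
    apply inv_anti₀ (by positivity)
    calc |z.im| / 2 / (2 * ‖z‖) ≤ |w.im| / ‖w‖ := by gcongr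
      _ ≤ _ := abs_im_div_norm_le hwim t
  · exact intervalIntegrable_const
  · filter_upwards with t ht w hw
    obtain ⟨h1, h2⟩ := hball w hw
    have hwim : w.im ≠ 0 := by
      intro h; rw [h, abs_zero] at h1; linarith
    rw [Set.uIoc_of_le zero_le_one] at ht
    have ht0 : (t : ℂ) ≠ 0 := by exact_mod_cast ht.1.ne'
    have hne := Complex.slitPlane_ne_zero (one_sub_mul_mem_slitPlane hwim t)
    have h1 : HasDerivAt (fun w : ℂ => 1 - (t : ℂ) * w) (-t) w := by
      simpa using ((hasDerivAt_id w).const_mul (t : ℂ)).const_sub 1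
    refine ((h1.clog (one_sub_mul_mem_slitPlane hwim t)).div_const (t : ℂ)).congr_deriv ?_
    field_simp

lemma abs_arg_le_abs_im_div_re {w : ℂ} (hw : 0 < w.re) : |w.arg| ≤ |w.im| / w.re := by
  have hlt : |w.arg| < Real.pi / 2 := Complex.abs_arg_lt_pi_div_two_iff.2 (Or.inl hw)
  have h := Real.le_tan (abs_nonneg _) hlt
  have e : Real.tan |w.arg| = |Real.tan w.arg| := by
    rcases le_total 0 w.arg with h0 | h0
    · rw [abs_of_nonneg h0, abs_of_nonneg]
      rw [abs_of_nonneg h0] at hlt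
      exact Real.tan_nonneg_of_nonneg_of_le_pi_div_two h0 hlt.le
    · rw [abs_of_nonpos h0] at hlt ⊢
      rw [Real.tan_neg, abs_of_nonpos]
      have := Real.tan_nonneg_of_nonneg_of_le_pi_div_two (neg_nonneg.2 h0) hlt.le
      rw [Real.tan_neg] at this; linarith
  rw [e, Complex.tan_arg, abs_div, abs_of_pos hw] at h
  exact h

/-- The imaginary part of the integrand is arg(1-tz)/t. As Re(1-tz) ≥ m along the segment, the
argument is at most t|Im z|/m and the factor t cancels. Hence Im Li₂ tends to 0 at real points below
1. -/
lemma abs_dilog_im_le {z : ℂ} (hz : z.im ≠ 0) {m : ℝ} (hm0 : 0 < m) (hm1 : m ≤ 1)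
    (hm : m ≤ (1 - z).re) : |(dilog z).im| ≤ |z.im| / m := by
  have e : (dilog z).im = -∫ t in (0 : ℝ)..1, (Complex.log (1 - t * z) / t).im := by
    rw [dilog, Complex.neg_im]
    congr 1
    exact (Complex.imCLM.intervalIntegral_comp_comm (intervalIntegrable_dilog hz)).symm
  rw [e, abs_neg, ← Real.norm_eq_abs]
  have := intervalIntegral.norm_integral_le_of_norm_le_const (a := (0 : ℝ)) (b := 1)
    (f := fun t : ℝ => (Complex.log (1 - t * z) / t).im) (C := |z.im| / m) ?_
  · simpa using this
  · intro t ht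
    rw [Set.uIoc_of_le zero_le_one] at ht
    have hre : m ≤ (1 - t * z).re := by
      simp at hm ⊢
      nlinarith [ht.1, ht.2]
    have h1 := abs_arg_le_abs_im_div_re (hm0.trans_le hre)
    rw [Complex.div_ofReal_im, Complex.log_im, Real.norm_eq_abs, abs_div, abs_of_pos ht.1,
      div_le_iff₀ ht.1]
    refine h1.trans ?_
    have e2 : |(1 - t * z).im| = t * |z.im| := by
      simp [abs_mul, abs_of_pos ht.1]
    rw [e2]
    calc t * |z.im| / (1 - t * z).re ≤ t * |z.im| / m := by
          have := ht.1; gcongr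
      _ = |z.im| / m * t := by ring

/-! ### Primitives for the two sums and their limits at real ends -/

/-- A function whose derivative is `(u-1) logLevel'`. -/
def primLambda (ρ : ℝ) (u : ℂ) : ℂ := u - 2 * (1 - ρ) * Complex.log (1 + u)

/-- A function whose derivative is `log(1+u) logLevel'`. -/
def primG (ρ : ℝ) (u : ℂ) : ℂ :=
  (1 - ρ) / 2 * Complex.log (1 + u) ^ 2 - ρ * dilog (1 / 2 - u / 2)
    + ρ * Real.log 2 * Complex.log (1 - u)

lemma hasDerivAt_primLambda (ρ : ℝ) {u : ℂ} (hu : 0 < u.im) :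
    HasDerivAt (primLambda ρ) ((u - 1) * logLevelDeriv ρ u) u := by
  have h1 := one_sub_ne_zero_of_im_pos hu
  have h2 := one_add_ne_zero_of_im_pos hu
  refine ((hasDerivAt_id u).sub ((hasStrictDerivAt_log_one_add hu).hasDerivAt.const_mul
    (2 * (1 - ρ) : ℂ))).congr_deriv ?_
  unfold logLevelDeriv
  field_simp
  ring

/-- The dilogarithm term contributes -ρ(log(1+u) - log 2)/(1-u); the last term of `primG` removes
the log 2. -/
lemma hasDerivAt_primG (ρ : ℝ) {u : ℂ} (hu : 0 < u.im) :
    HasDerivAt (primG ρ) (Complex.log (1 + u) * logLevelDeriv ρ u) u := by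
  have h1 := one_sub_ne_zero_of_im_pos hu
  have h2 := one_add_ne_zero_of_im_pos hu
  have hzim : (1 / 2 - u / 2).im ≠ 0 := by
    have : (1 / 2 - u / 2).im = -(u.im / 2) := by simp
    rw [this]; exact neg_ne_zero.2 (by positivity)
  have hz : HasDerivAt (fun u : ℂ => 1 / 2 - u / 2) (-(1 / 2)) u := by
    exact ((hasDerivAt_id u).div_const 2).const_sub (1 / 2)
  have hd := (hasDerivAt_dilog hzim).comp u hz
  have hl := (hasStrictDerivAt_log_one_add hu).hasDerivAt
  have hl' := (hasStrictDerivAt_log_one_sub hu).hasDerivAt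
  have elog : Complex.log (1 - (1 / 2 - u / 2)) = Complex.log (1 + u) - Real.log 2 := by
    have e : 1 - (1 / 2 - u / 2) = ((2⁻¹ : ℝ) : ℂ) * (1 + u) := by push_cast; ring
    rw [e, Complex.log_ofReal_mul (by norm_num) h2, Real.log_inv]; push_cast; ring
  rw [elog] at hd
  have h3 : (1 : ℂ) / 2 - u / 2 ≠ 0 := by
    intro h; apply h1; linear_combination 2 * h
  have := (((hl.pow 2).const_mul ((1 - ρ) / 2 : ℂ)).sub (hd.const_mul (ρ : ℂ))).add
    (hl'.const_mul (ρ * Real.log 2 : ℂ))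
  refine this.congr_deriv ?_
  have e3 : (1 : ℂ) / 2 - u / 2 = (1 - u) / 2 := by ring
  rw [e3]
  unfold logLevelDeriv
  field_simp
  push_cast
  ring

lemma primLambda_im (ρ : ℝ) (u : ℂ) :
    (primLambda ρ u).im = u.im - 2 * (1 - ρ) * (1 + u).arg := by
  have e : primLambda ρ u = u - ((2 * (1 - ρ) : ℝ) : ℂ) * Complex.log (1 + u) := by
    simp [primLambda]
  rw [e, Complex.sub_im, Complex.im_ofReal_mul, Complex.log_im]

lemma primG_im (ρ : ℝ) (u : ℂ) :
    (primG ρ u).im = (1 - ρ) * Real.log ‖1 + u‖ * (1 + u).arg - ρ * (dilog (1 / 2 - u / 2)).im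
      + ρ * Real.log 2 * (1 - u).arg := by
  have e : primG ρ u = (((1 - ρ) / 2 : ℝ) : ℂ) * Complex.log (1 + u) ^ 2
      - (ρ : ℂ) * dilog (1 / 2 - u / 2) + ((ρ * Real.log 2 : ℝ) : ℂ) * Complex.log (1 - u) := by
    simp [primG]
  rw [e, Complex.add_im, Complex.sub_im, Complex.im_ofReal_mul, Complex.im_ofReal_mul,
    Complex.im_ofReal_mul, sq, Complex.mul_im, Complex.log_im, Complex.log_im, Complex.log_re]
  ring

lemma GInf_eq {ρ : ℝ} (hρ0 : 0 < ρ) (u : ℂ) : GInf ρ u = (primG ρ u).im / (ρ * Real.pi) := by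
  have := Real.pi_pos
  rw [GInf, primG_im]; field_simp; ring

lemma LambdaInf_eq (ρ : ℝ) (u : ℂ) : LambdaInf ρ u = (primLambda ρ u).im / (2 * Real.pi) := by
  have := Real.pi_pos
  rw [LambdaInf, primLambda_im]; field_simp; ring

lemma levelPoint_bounds {ρ r R ψ : ℝ} (hρ0 : 0 < ρ) (hρ1 : ρ < 1) (hr : 0 < r) (hrR : r ≤ R)
    (hR : 1 ≤ R) (hψ0 : 0 < ψ) (hψ : ψ < ρ * Real.pi) :
    ‖levelPoint ρ r ψ‖ ≤ 1 + R ∧ distBound ρ ≤ ‖1 + levelPoint ρ r ψ‖ := by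
  obtain ⟨hu, hW⟩ := levelPoint_spec hρ0 hρ1 hr hψ0 hψ
  refine ⟨norm_le_of_logLevel_re hρ0 hρ1 hr hrR hR (by rw [hW, levelValue_re]),
    distBound_le_norm hρ0 hu ?_⟩
  rw [hW, levelValue_im]; linarith

lemma norm_one_add_le_of_norm_le {u : ℂ} {R : ℝ} (h : ‖u‖ ≤ 1 + R) : ‖1 + u‖ ≤ 2 + R := by
  have := norm_add_le 1 u
  rw [norm_one] at this; linarith

/-- The bound for `|log |1+u||` on the level curves of radius at most `R`. -/
def logBound (ρ R : ℝ) : ℝ := |Real.log (distBound ρ)| + |Real.log (2 + R)|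

lemma abs_log_norm_le {ρ R : ℝ} (hρ0 : 0 < ρ) (hρ1 : ρ < 1) {u : ℂ} (h1 : ‖u‖ ≤ 1 + R)
    (h2 : distBound ρ ≤ ‖1 + u‖) : |Real.log ‖1 + u‖| ≤ logBound ρ R := by
  have hd := distBound_pos hρ0 hρ1
  have l1 := Real.log_le_log hd h2
  have l2 := Real.log_le_log (hd.trans_le h2) (norm_one_add_le_of_norm_le h1)
  unfold logBound
  rw [abs_le]
  constructor
  · linarith [neg_abs_le (Real.log (distBound ρ)), abs_nonneg (Real.log (2 + R))]
  · linarith [le_abs_self (Real.log (2 + R)), abs_nonneg (Real.log (distBound ρ))]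

/-- At an end of the level curve on the real axis, to the right of `-1`. -/
lemma tendsto_real_end {ρ r ψ₀ : ℝ} (hρ0 : 0 < ρ) (hρ1 : ρ < 1) (hr : 0 < r) {l : Filter ℝ}
    (hl : l ≤ 𝓝 ψ₀) (hmem : ∀ᶠ ψ in l, ψ ∈ Set.Ioo 0 (ρ * Real.pi))
    (harg : Tendsto (fun ψ => (1 + levelPoint ρ r ψ).arg) l (𝓝 0)) :
    Tendsto (fun ψ => (levelPoint ρ r ψ).im) l (𝓝 0) ∧
    Tendsto (fun ψ => (primLambda ρ (levelPoint ρ r ψ)).im) l (𝓝 0) ∧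
    Tendsto (fun ψ => (primG ρ (levelPoint ρ r ψ)).im) l
      (𝓝 (Real.log 2 * (ψ₀ - ρ * Real.pi))) := by
  set R := max 1 r
  have hb : ∀ᶠ ψ in l, 0 < (levelPoint ρ r ψ).im ∧ ‖levelPoint ρ r ψ‖ ≤ 1 + R ∧
      distBound ρ ≤ ‖1 + levelPoint ρ r ψ‖ := by
    filter_upwards [hmem] with ψ hψ
    exact ⟨(levelPoint_spec hρ0 hρ1 hr hψ.1 hψ.2).1,
      levelPoint_bounds hρ0 hρ1 hr (le_max_right _ _) (le_max_left _ _) hψ.1 hψ.2⟩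
  have him : Tendsto (fun ψ => (levelPoint ρ r ψ).im) l (𝓝 0) := by
    have hlim : Tendsto (fun ψ => (2 + R) * (1 + levelPoint ρ r ψ).arg) l (𝓝 0) := by
      simpa using harg.const_mul (2 + R)
    refine tendsto_of_tendsto_of_tendsto_of_le_of_le' tendsto_const_nhds hlim ?_ ?_
    · exact hb.mono fun ψ h => h.1.le
    · filter_upwards [hb] with ψ h
      have hα := arg_one_add_pos h.1
      have hn : 0 < ‖1 + levelPoint ρ r ψ‖ := norm_pos_iff.2 (one_add_ne_zero_of_im_pos h.1)
      have h3 := Real.sin_le hα.le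
      rw [Complex.sin_arg, div_le_iff₀ hn] at h3
      have h4 := norm_one_add_le_of_norm_le h.2.1
      simp only [Complex.add_im, Complex.one_im, zero_add] at h3
      nlinarith
  refine ⟨him, ?_, ?_⟩
  · simp only [primLambda_im]
    simpa using him.sub (harg.const_mul (2 * (1 - ρ)))
  · simp only [primG_im]
    have t1 : Tendsto (fun ψ => (1 - ρ) * Real.log ‖1 + levelPoint ρ r ψ‖ *
        (1 + levelPoint ρ r ψ).arg) l (𝓝 0) := by
      apply squeeze_zero_norm' (a := fun ψ => (1 - ρ) * logBound ρ R *
        |(1 + levelPoint ρ r ψ).arg|)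
      · filter_upwards [hb] with ψ h
        rw [norm_mul, norm_mul, Real.norm_eq_abs, Real.norm_eq_abs, Real.norm_eq_abs,
          abs_of_pos (by linarith : 0 < 1 - ρ)]
        have := abs_log_norm_le hρ0 hρ1 h.2.1 h.2.2
        have h1 : 0 < 1 - ρ := by linarith
        gcongr
      · simpa using harg.abs.const_mul ((1 - ρ) * logBound ρ R)
    have t2 : Tendsto (fun ψ => (dilog (1 / 2 - levelPoint ρ r ψ / 2)).im) l (𝓝 0) := by
      -- Once arg(1+u) < 1 its cosine is at least 1/2, so Re(1+u)/2 ≥ `distBound ρ` / 4.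
      set m := min 1 (distBound ρ / 4) with hm
      have hd := distBound_pos hρ0 hρ1
      have hm0 : 0 < m := by positivity
      apply squeeze_zero_norm' (a := fun ψ => (levelPoint ρ r ψ).im / 2 / m)
      · have hα : ∀ᶠ ψ in l, (1 + levelPoint ρ r ψ).arg < 1 :=
          harg.eventually (gt_mem_nhds zero_lt_one)
        filter_upwards [hb, hα] with ψ h hα
        have hz : (1 / 2 - levelPoint ρ r ψ / 2).im = -((levelPoint ρ r ψ).im / 2) := by simp
        have hzne : (1 / 2 - levelPoint ρ r ψ / 2).im ≠ 0 := by
          rw [hz]; exact neg_ne_zero.2 (by have := h.1; positivity)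
        have hc : 1 / 2 ≤ Real.cos (1 + levelPoint ρ r ψ).arg := by
          have h0 := arg_one_add_pos h.1
          have := Real.one_sub_sq_div_two_le_cos (x := (1 + levelPoint ρ r ψ).arg)
          nlinarith
        have hre : (1 + levelPoint ρ r ψ).re =
            ‖1 + levelPoint ρ r ψ‖ * Real.cos (1 + levelPoint ρ r ψ).arg := by
          rw [Complex.norm_mul_cos_arg]
        have hmz : m ≤ (1 - (1 / 2 - levelPoint ρ r ψ / 2)).re := by
          have e : (1 - (1 / 2 - levelPoint ρ r ψ / 2)).re = (1 + levelPoint ρ r ψ).re / 2 := by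
            simp; ring
          rw [e, hre]
          have : m ≤ distBound ρ / 4 := min_le_right _ _
          nlinarith [h.2.2]
        have := abs_dilog_im_le hzne hm0 (min_le_left _ _) hmz
        have hp : 0 < (levelPoint ρ r ψ).im / 2 := half_pos h.1
        rw [hz, abs_neg, abs_of_pos hp] at this
        exact this
      · simpa using (him.div_const 2).div_const m
    -- The only term that survives: arg(1+u) → 0 puts the whole weighted angle on arg(1-u).
    have t3 : Tendsto (fun ψ => ρ * (1 - levelPoint ρ r ψ).arg) l (𝓝 (ψ₀ - ρ * Real.pi)) := by
      have hlim : Tendsto (fun ψ => ψ - ρ * Real.pi - (1 - ρ) * (1 + levelPoint ρ r ψ).arg) l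
          (𝓝 (ψ₀ - ρ * Real.pi - (1 - ρ) * 0)) :=
        ((tendsto_id.mono_left hl).sub_const _).sub (harg.const_mul _)
      rw [mul_zero, sub_zero] at hlim
      refine hlim.congr' ?_
      filter_upwards [hmem] with ψ hψ
      have := congrArg Complex.im (levelPoint_spec hρ0 hρ1 hr hψ.1 hψ.2).2
      rw [logLevel_im, levelValue_im] at this
      linarith
    have t4 := (t1.sub (t2.const_mul ρ)).add (t3.const_mul (Real.log 2))
    simp only [mul_zero, sub_zero, zero_add] at t4
    refine t4.congr fun ψ => ?_
    ring

/-! ### Riemann sums of monotone functions -/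

section MonotoneSums

variable {T Δ M a b : ℝ} {φ h : ℝ → ℝ}

lemma exists_slope_of_hasDerivAt (hd : ∀ x ∈ Set.Ioo 0 T, HasDerivAt h (φ x) x) {x y : ℝ}
    (hx : 0 < x) (hxy : x < y) (hy : y < T) :
    ∃ c ∈ Set.Ioo x y, h y - h x = φ c * (y - x) := by
  have hmem : ∀ z ∈ Set.Icc x y, z ∈ Set.Ioo 0 T := fun z hz =>
    ⟨hx.trans_le hz.1, hz.2.trans_lt hy⟩
  obtain ⟨c, hc, hc'⟩ := exists_hasDerivAt_eq_slope h φ hxy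
    (fun z hz => (hd z (hmem z hz)).continuousAt.continuousWithinAt)
    (fun z hz => hd z (hmem z ⟨hz.1.le, hz.2.le⟩))
  refine ⟨c, hc, ?_⟩
  rw [hc', div_mul_cancel₀ _ (sub_pos.2 hxy).ne']

lemma abs_sub_le_of_hasDerivAt (hd : ∀ x ∈ Set.Ioo 0 T, HasDerivAt h (φ x) x)
    (hM : ∀ x ∈ Set.Ioo 0 T, |φ x| ≤ M) {x y : ℝ}
    (hx : 0 < x) (hxy : x < y) (hy : y < T) : |h y - h x| ≤ M * (y - x) := by
  obtain ⟨c, hc, e⟩ := exists_slope_of_hasDerivAt hd hx hxy hy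
  rw [e, abs_mul, abs_of_pos (sub_pos.2 hxy)]
  exact mul_le_mul_of_nonneg_right (hM c ⟨hx.trans hc.1, hc.2.trans hy⟩) (sub_pos.2 hxy).le

lemma abs_sub_left_limit_le (hd : ∀ x ∈ Set.Ioo 0 T, HasDerivAt h (φ x) x)
    (hM : ∀ x ∈ Set.Ioo 0 T, |φ x| ≤ M) (h0 : Tendsto h (𝓝[>] 0) (𝓝 a)) {x : ℝ}
    (hx : 0 < x) (hxT : x < T) : |h x - a| ≤ M * x := by
  have l1 : Tendsto (fun y => |h x - h y|) (𝓝[>] 0) (𝓝 |h x - a|) := (h0.const_sub _).abs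
  have l2 : Tendsto (fun y : ℝ => M * (x - y)) (𝓝[>] 0) (𝓝 (M * (x - 0))) :=
    ((tendsto_id.mono_left nhdsWithin_le_nhds).const_sub x).const_mul M
  rw [sub_zero] at l2
  refine le_of_tendsto_of_tendsto l1 l2 ?_
  filter_upwards [Ioo_mem_nhdsGT hx] with y hy
  exact abs_sub_le_of_hasDerivAt hd hM hy.1 hy.2 hxT

lemma abs_right_limit_sub_le (hd : ∀ x ∈ Set.Ioo 0 T, HasDerivAt h (φ x) x)
    (hM : ∀ x ∈ Set.Ioo 0 T, |φ x| ≤ M) (h1 : Tendsto h (𝓝[<] T) (𝓝 b)) {x : ℝ}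
    (hx : 0 < x) (hxT : x < T) : |b - h x| ≤ M * (T - x) := by
  have l1 : Tendsto (fun y => |h y - h x|) (𝓝[<] T) (𝓝 |b - h x|) := (h1.sub_const _).abs
  have l2 : Tendsto (fun y : ℝ => M * (y - x)) (𝓝[<] T) (𝓝 (M * (T - x))) :=
    ((tendsto_id.mono_left nhdsWithin_le_nhds).sub_const x).const_mul M
  refine le_of_tendsto_of_tendsto l1 l2 ?_
  filter_upwards [Ioo_mem_nhdsLT hxT] with y hy
  exact abs_sub_le_of_hasDerivAt hd hM hx hy.1 hy.2

/-- By the mean value theorem each increment of h is Δ times a value between neighbouring samples.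
The errors are at most Δ times the drops of φ, and these telescope, so n does not enter. -/
lemma abs_sum_sub_primitive_le (hΔ : 0 < Δ) (hanti : AntitoneOn φ (Set.Ioo 0 T))
    (hd : ∀ x ∈ Set.Ioo 0 T, HasDerivAt h (φ x) x) {x : ℝ} (hx : 0 < x) (n : ℕ)
    (hn : x + n * Δ < T) :
    |Δ * ∑ i ∈ Finset.range n, φ (x + i * Δ) - (h (x + n * Δ) - h x)|
      ≤ Δ * (φ x - φ (x + n * Δ)) := by
  induction n with
  | zero => simp
  | succ n ih =>
    have e : x + ((n + 1 : ℕ) : ℝ) * Δ = x + n * Δ + Δ := by push_cast; ring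
    rw [e] at hn ⊢
    have hpos : 0 < x + n * Δ := by positivity
    obtain ⟨c, hc, hc'⟩ := exists_slope_of_hasDerivAt hd hpos (lt_add_of_pos_right _ hΔ) hn
    have m1 : x + n * Δ ∈ Set.Ioo 0 T := ⟨hpos, by linarith⟩
    have m2 : x + n * Δ + Δ ∈ Set.Ioo 0 T := ⟨by linarith, hn⟩
    have mc : c ∈ Set.Ioo 0 T := ⟨hpos.trans hc.1, hc.2.trans hn⟩
    have k1 := hanti m1 mc hc.1.le
    have k2 := hanti mc m2 hc.2.le
    have ih' := abs_le.1 (ih (by linarith))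
    rw [Finset.sum_range_succ, abs_le]
    have k3 := mul_le_mul_of_nonneg_left k1 hΔ.le
    have k4 := mul_le_mul_of_nonneg_left k2 hΔ.le
    constructor <;> nlinarith

/-- Comparison of a Riemann sum of a bounded monotone function with the integral, the latter given
by the limits of a primitive at the end points. -/
lemma abs_sum_sub_limits_le (hT : 0 < T) (hΔ : 0 < Δ) (hanti : AntitoneOn φ (Set.Ioo 0 T))
    (hM : ∀ x ∈ Set.Ioo 0 T, |φ x| ≤ M) (hd : ∀ x ∈ Set.Ioo 0 T, HasDerivAt h (φ x) x)
    (h0 : Tendsto h (𝓝[>] 0) (𝓝 a)) (h1 : Tendsto h (𝓝[<] T) (𝓝 b)) {x : ℝ} (hx : 0 < x)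
    (hxΔ : x ≤ Δ) (n : ℕ) (hn : T ≤ x + n * Δ) (hlt : ∀ i < n, x + i * Δ < T) :
    |Δ * ∑ i ∈ Finset.range n, φ (x + i * Δ) - (b - a)| ≤ 5 * M * Δ := by
  have hM0 : 0 ≤ M := (abs_nonneg _).trans (hM (T / 2) ⟨by linarith, by linarith⟩)
  cases n with
  | zero =>
    have k1 := abs_le.1 (abs_sub_left_limit_le hd hM h0 (x := T / 2) (by linarith) (by linarith))
    have k2 := abs_le.1 (abs_right_limit_sub_le hd hM h1 (x := T / 2) (by linarith) (by linarith))
    have hTΔ : T ≤ Δ := by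
      simp only [Nat.cast_zero, zero_mul, add_zero] at hn; linarith
    have k3 := mul_le_mul_of_nonneg_left hTΔ hM0
    have k4 : 0 ≤ M * Δ := by positivity
    simp only [Finset.range_zero, Finset.sum_empty, mul_zero, zero_sub, abs_neg]
    rw [abs_le]
    constructor <;> nlinarith
  | succ n =>
    -- The constant 5 counts 2 for the total drop of φ and 1 each for the last sample and the two
    -- end gaps.
    have hlast := hlt n (Nat.lt_succ_self n)
    have hpos : 0 < x + n * Δ := by positivity
    have hxT : x < T := by simpa using hlt 0 (Nat.succ_pos n)
    have k0 := abs_le.1 (abs_sum_sub_primitive_le hΔ hanti hd hx n hlast)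
    have k1 := abs_le.1 (abs_sub_left_limit_le hd hM h0 hx hxT)
    have k2 := abs_le.1 (abs_right_limit_sub_le hd hM h1 hpos hlast)
    have k3 := abs_le.1 (hM x ⟨hx, hxT⟩)
    have k4 := abs_le.1 (hM _ ⟨hpos, hlast⟩)
    have k5 : T - (x + n * Δ) ≤ Δ := by push_cast at hn; linarith
    have k6 := mul_le_mul_of_nonneg_left k5 hM0
    have k7 := mul_le_mul_of_nonneg_left hxΔ hM0
    have k8 := mul_le_mul_of_nonneg_left k3.2 hΔ.le
    have k9 := mul_le_mul_of_nonneg_left k4.1 hΔ.le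
    have k10 := mul_le_mul_of_nonneg_left k4.2 hΔ.le
    rw [Finset.sum_range_succ, abs_le]
    constructor <;> nlinarith

end MonotoneSums

/-- The sum over all labels, for values that are symmetric with respect to the middle label and
that are sampled from a function with monotone real part. -/
lemma norm_sum_labels_sub_le {p q : ℕ} (hp : 0 < p) (hq : q = p ∨ q = p + 1) {M a b : ℝ}
    {v : ℕ → ℂ} {φ : ℝ → ℂ} {h : ℝ → ℝ}
    (hpos : ∀ j, 1 ≤ j → j < q → q < 2 * j → v j = φ (2 * j - q))
    (hneg : ∀ j, 1 ≤ j → 2 * j < q → v j = (starRingEnd ℂ) (φ (q - 2 * j)))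
    (hv : ∀ j, 1 ≤ j → j ≤ p → ‖v j‖ ≤ M)
    (hanti : AntitoneOn (fun x => (φ x).re) (Set.Ioo 0 (p : ℝ)))
    (hM : ∀ x ∈ Set.Ioo 0 (p : ℝ), |(φ x).re| ≤ M)
    (hd : ∀ x ∈ Set.Ioo 0 (p : ℝ), HasDerivAt h (φ x).re x)
    (h0 : Tendsto h (𝓝[>] 0) (𝓝 a)) (h1 : Tendsto h (𝓝[<] (p : ℝ)) (𝓝 b)) :
    ‖∑ j ∈ Finset.Icc 1 p, v j - ((b - a : ℝ) : ℂ)‖ ≤ 12 * M := by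
  have hM0 : 0 ≤ M := (norm_nonneg _).trans (hv 1 le_rfl hp)
  -- The reflection j ↔ q-j pairs n labels on each side, sampled at s, s+2, …; s = 2 exactly when
  -- there is a middle label j = q/2. The middle label and the label j = p = q, when present, cost M
  -- each, on top of 10M from the Riemann sum.
  obtain ⟨n, s, hs, hqs⟩ : ∃ n s : ℕ, (s = 1 ∨ s = 2) ∧ q = 2 * n + s := by
    refine ⟨(q - 1) / 2, q - 2 * ((q - 1) / 2), ?_, ?_⟩ <;> omega
  have hs1 : (1 : ℝ) ≤ s := by rcases hs with rfl | rfl <;> norm_num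
  have hs2 : (s : ℝ) ≤ 2 := by rcases hs with rfl | rfl <;> norm_num
  have hqR : (q : ℝ) = 2 * n + s := by rw [hqs]; push_cast; ring
  have hpq : (p : ℝ) ≤ q := by
    have : p ≤ q := by omega
    exact_mod_cast this
  have hqp : (q : ℝ) ≤ p + 1 := by
    have : q ≤ p + 1 := by omega
    exact_mod_cast this
  have hsum := abs_sum_sub_limits_le (T := (p : ℝ)) (Δ := 2) (by exact_mod_cast hp) two_pos hanti
    hM hd h0 h1 (x := s) (by linarith) hs2 n (by linarith) (fun i hi => by
      have : (i : ℝ) + 1 ≤ n := by exact_mod_cast hi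
      linarith)
  have hP : ∑ j ∈ Finset.Ico (n + s) q, v j = ∑ i ∈ Finset.range n, φ (s + i * 2) := by
    rw [Finset.sum_Ico_eq_sum_range]
    have e : q - (n + s) = n := by omega
    rw [e]
    refine Finset.sum_congr rfl fun i hi => ?_
    rw [Finset.mem_range] at hi
    rw [hpos _ (by omega) (by omega) (by omega), hqR]
    congr 1
    push_cast; ring
  have hN : ∑ j ∈ Finset.Ico 1 (n + 1), v j
      = ∑ i ∈ Finset.range n, (starRingEnd ℂ) (φ (s + i * 2)) := by
    rw [Finset.sum_Ico_eq_sum_range, ← Finset.sum_range_reflect]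
    simp only [Nat.add_sub_cancel]
    refine Finset.sum_congr rfl fun i hi => ?_
    rw [Finset.mem_range] at hi
    rw [hneg _ (by omega) (by omega), hqR]
    have e : ((1 + (n - 1 - i) : ℕ) : ℝ) = n - i := by
      have : 1 + (n - 1 - i) = n - i := by omega
      rw [this, Nat.cast_sub hi.le]
    rw [e]
    congr 2
    ring
  have hmid : ‖∑ j ∈ Finset.Ico (n + 1) (n + s), v j‖ ≤ M := by
    rcases hs with rfl | rfl
    · simpa using hM0
    · have : Finset.Ico (n + 1) (n + 2) = {n + 1} := by
        ext; simp
      rw [this, Finset.sum_singleton]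
      exact hv _ (by omega) (by omega)
  obtain ⟨w, hw, hsplit⟩ : ∃ w : ℂ, ‖w‖ ≤ M ∧
      ∑ j ∈ Finset.Icc 1 p, v j = ∑ j ∈ Finset.Ico 1 q, v j + w := by
    rcases hq with rfl | rfl
    · refine ⟨v q, hv q hp le_rfl, ?_⟩
      rw [← Finset.sum_Ico_succ_top hp]; rfl
    · exact ⟨0, by simpa using hM0, by rw [add_zero]; rfl⟩
  have hall : ∑ j ∈ Finset.Ico 1 q, v j = ∑ j ∈ Finset.Ico 1 (n + 1), v j
      + ∑ j ∈ Finset.Ico (n + 1) (n + s), v j + ∑ j ∈ Finset.Ico (n + s) q, v j := by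
    rw [Finset.sum_Ico_consecutive _ (by omega) (by omega),
      Finset.sum_Ico_consecutive _ (by omega) (by omega)]
  have hPN : ∑ j ∈ Finset.Ico 1 (n + 1), v j + ∑ j ∈ Finset.Ico (n + s) q, v j
      = ((2 * ∑ i ∈ Finset.range n, (φ (s + i * 2)).re : ℝ) : ℂ) := by
    rw [hP, hN, ← Finset.sum_add_distrib]
    push_cast
    rw [Finset.mul_sum]
    refine Finset.sum_congr rfl fun i _ => ?_
    rw [add_comm, Complex.add_conj]; push_cast; ring
  have e : ∑ j ∈ Finset.Icc 1 p, v j - ((b - a : ℝ) : ℂ)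
      = ((2 * ∑ i ∈ Finset.range n, (φ (s + i * 2)).re - (b - a) : ℝ) : ℂ)
        + ∑ j ∈ Finset.Ico (n + 1) (n + s), v j + w := by
    rw [hsplit, hall, Complex.ofReal_sub _ (b - a), ← hPN]; ring
  rw [e]
  have := norm_add₃_le (a := ((2 * ∑ i ∈ Finset.range n, (φ (s + i * 2)).re - (b - a) : ℝ) : ℂ))
    (b := ∑ j ∈ Finset.Ico (n + 1) (n + s), v j) (c := w)
  rw [Complex.norm_real, Real.norm_eq_abs] at this
  linarith

/-! ### Labels of the Bethe roots -/

lemma pos_of_density {ρ : ℝ} (hρ0 : 0 < ρ) {N p : ℕ} (hN : 0 < N) (hp : (p : ℝ) = ρ * N) :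
    0 < p := by
  have : (0 : ℝ) < p := by rw [hp]; positivity
  exact_mod_cast this

lemma lt_of_density {ρ : ℝ} (hρ1 : ρ < 1) {N p : ℕ} (hN : 0 < N) (hp : (p : ℝ) = ρ * N) :
    p < N := by
  have hN' : (0 : ℝ) < N := by exact_mod_cast hN
  have : (p : ℝ) < N := by rw [hp]; nlinarith
  exact_mod_cast this

/-- For j ≤ p the interval already lies in (-p,p] ⊂ (-N,N], so reduction modulo 2N does nothing. -/
lemma mem_labelInterval_iff {N p j : ℕ} (hpN : p < N) (hj1 : 1 ≤ j) (hjp : j ≤ p) (x : ℝ) :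
    x ∈ labelInterval N p j ↔ x ∈ Set.Ioc (-(p : ℝ) + 2 * ((j : ℝ) - 1)) (-(p : ℝ) + 2 * j) := by
  have h1 : (1 : ℝ) ≤ j := by exact_mod_cast hj1
  have h2 : (j : ℝ) ≤ p := by exact_mod_cast hjp
  have h3 : (p : ℝ) < N := by exact_mod_cast hpN
  constructor
  · rintro ⟨hx, k, hk⟩
    have hk1 : (-1 : ℝ) < k := by
      by_contra! h
      nlinarith [hx.1, hx.2, hk.1, hk.2]
    have hk2 : (k : ℝ) < 1 := by
      by_contra! h
      nlinarith [hx.1, hx.2, hk.1, hk.2]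
    have hk0 : k = 0 := by
      have a1 : (-1 : ℤ) < k := by exact_mod_cast hk1
      have a2 : k < (1 : ℤ) := by exact_mod_cast hk2
      omega
    simpa [hk0] using hk
  · intro hx
    refine ⟨⟨by linarith [hx.1], by linarith [hx.2]⟩, 0, by simpa using hx⟩

lemma arg_sub_one_eq {u : ℂ} (hu : 0 < u.im) : (u - 1).arg = (1 - u).arg + Real.pi := by
  have h := Complex.arg_neg_eq_arg_sub_pi_of_im_pos (x := u - 1) (by simpa using hu)
  rw [neg_sub] at h
  linarith

/-- Above the real axis arg(u-1) = arg(1-u) + π, which makes the label the weighted angle ψ scaled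
by N/π. -/
lemma labelFun_eq_of_im_pos {ρ : ℝ} {N p : ℕ} (hp : (p : ℝ) = ρ * N) {u : ℂ} (hu : 0 < u.im) :
    labelFun N p u = N / Real.pi * ((logLevel ρ u).im + ρ * Real.pi) := by
  rw [labelFun, arg_sub_one_eq hu, logLevel_im, hp, add_comm u]
  ring

lemma labelFun_conj {N p : ℕ} {u : ℂ} (hu : u.im ≠ 0) :
    labelFun N p ((starRingEnd ℂ) u) = -labelFun N p u := by
  have h : ∀ c : ℝ, ((starRingEnd ℂ) u + c).arg = -(u + c).arg := by
    intro c
    have e : (starRingEnd ℂ) u + c = (starRingEnd ℂ) (u + c) := by simp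
    rw [e, Complex.arg_conj, if_neg]
    intro h
    exact hu (by simpa using (Complex.arg_eq_pi_iff.1 h).2)
  have h1 := h (-1)
  have h2 := h 1
  push_cast at h1 h2
  rw [labelFun, labelFun, sub_eq_add_neg, h1, h2, sub_eq_add_neg u]
  ring

lemma IsBetheRoot.conj {N p : ℕ} {C u : ℂ} (h : IsBetheRoot N p C u) :
    IsBetheRoot N p ((starRingEnd ℂ) C) ((starRingEnd ℂ) u) := by
  unfold IsBetheRoot at h ⊢
  rw [← h]; simp

lemma exp_mul_logLevel {ρ : ℝ} {N p : ℕ} (hpN : p < N) (hp : (p : ℝ) = ρ * N) {u : ℂ}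
    (h1 : 1 - u ≠ 0) (h2 : 1 + u ≠ 0) :
    Complex.exp (N * logLevel ρ u) = (1 - u) ^ p * (1 + u) ^ (N - p) := by
  have hp' : (p : ℂ) = ρ * N := by exact_mod_cast congrArg (fun x : ℝ => (x : ℂ)) hp
  have e : (N : ℂ) * logLevel ρ u
      = p * Complex.log (1 - u) + ((N - p : ℕ) : ℂ) * Complex.log (1 + u) := by
    rw [Nat.cast_sub hpN.le, hp', logLevel]; ring
  rw [e, Complex.exp_add, Complex.exp_nat_mul, Complex.exp_nat_mul, Complex.exp_log h1,
    Complex.exp_log h2]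

/-- The level equation of a root of modulus data `r^p`. -/
lemma IsBetheRoot.logLevel_re_eq {ρ r δ : ℝ} {N p : ℕ} (hN : 0 < N) (hpN : p < N)
    (hp : (p : ℝ) = ρ * N) (hp0 : 0 < p) (hr : 0 < r) {u : ℂ}
    (h : IsBetheRoot N p ((r : ℂ) ^ p * Complex.exp (δ * Complex.I)) u) :
    1 - u ≠ 0 ∧ 1 + u ≠ 0 ∧ (logLevel ρ u).re = ρ * Real.log r := by
  unfold IsBetheRoot at h
  have hn := congrArg norm h
  rw [norm_mul, norm_mul, norm_pow, norm_pow, norm_pow, Complex.norm_exp_ofReal_mul_I,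
    Complex.norm_real, Real.norm_of_nonneg hr.le, mul_one] at hn
  have hrp : 0 < r ^ p := by positivity
  have h1 : ‖1 - u‖ ≠ 0 := by
    intro h0; rw [h0, zero_pow hp0.ne', zero_mul] at hn; linarith
  have h2 : ‖1 + u‖ ≠ 0 := by
    intro h0; rw [h0, zero_pow (by omega), mul_zero] at hn; linarith
  refine ⟨norm_ne_zero_iff.1 h1, norm_ne_zero_iff.1 h2, ?_⟩
  have hl := congrArg Real.log hn
  rw [Real.log_mul (pow_ne_zero _ h1) (pow_ne_zero _ h2), Real.log_pow, Real.log_pow, Real.log_pow,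
    Nat.cast_sub hpN.le, hp] at hl
  have hN' : (0 : ℝ) < N := by exact_mod_cast hN
  rw [logLevel_re]
  apply mul_left_cancel₀ hN'.ne'
  linear_combination hl

/-- The label of a root is determined modulo `2`. -/
lemma IsBetheRoot.labelFun_eq {r δ : ℝ} {N p : ℕ} (hpN : p < N) (hr : 0 < r) {u : ℂ}
    (h : IsBetheRoot N p ((r : ℂ) ^ p * Complex.exp (δ * Complex.I)) u) :
    ∃ k : ℤ, labelFun N p u = -p + δ / Real.pi + 2 * k := by
  unfold IsBetheRoot at h
  have hπ := Real.pi_pos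
  -- Writing 1-u through arg(u-1) + π is the source of the shift by p in the label.
  have e1 : 1 - u = ‖u - 1‖ * Complex.exp (((u - 1).arg + Real.pi) * Complex.I) := by
    rw [add_mul, Complex.exp_add, Complex.exp_pi_mul_I, ← mul_assoc,
      Complex.norm_mul_exp_arg_mul_I]
    ring
  have e2 : 1 + u = ‖u + 1‖ * Complex.exp ((u + 1).arg * Complex.I) := by
    rw [Complex.norm_mul_exp_arg_mul_I]; ring
  have e3 : ((‖u - 1‖ ^ p * ‖u + 1‖ ^ (N - p) : ℝ) : ℂ)
      * Complex.exp (((Real.pi * (labelFun N p u + p) : ℝ) : ℂ) * Complex.I)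
      = ((r ^ p : ℝ) : ℂ) * Complex.exp (δ * Complex.I) := by
    push_cast
    rw [← h, e1, e2, mul_pow, mul_pow, ← Complex.exp_nat_mul, ← Complex.exp_nat_mul]
    rw [mul_mul_mul_comm, ← Complex.exp_add]
    congr 2
    have : Real.pi * labelFun N p u = p * (u - 1).arg + ((N : ℝ) - p) * (u + 1).arg := by
      unfold labelFun; field_simp
    have this' := congrArg (fun x : ℝ => (x : ℂ)) this
    push_cast at this'
    rw [Nat.cast_sub hpN.le]
    linear_combination Complex.I * this'
  have e4 : (‖u - 1‖ ^ p * ‖u + 1‖ ^ (N - p) : ℝ) = r ^ p := by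
    have := congrArg norm e3
    rw [norm_mul, norm_mul, Complex.norm_exp_ofReal_mul_I, Complex.norm_exp_ofReal_mul_I,
      Complex.norm_real, Complex.norm_real, Real.norm_of_nonneg (by positivity),
      Real.norm_of_nonneg (by positivity)] at this
    simpa using this
  rw [e4] at e3
  have hrp : ((r ^ p : ℝ) : ℂ) ≠ 0 := by
    have : r ^ p ≠ 0 := by positivity
    exact_mod_cast this
  obtain ⟨k, hk⟩ := Complex.exp_eq_exp_iff_exists_int.1 (mul_left_cancel₀ hrp e3)
  refine ⟨k, ?_⟩
  have hk' : ((Real.pi * (labelFun N p u + p) : ℝ) : ℂ) = ((δ + k * (2 * Real.pi) : ℝ) : ℂ) := by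
    apply mul_right_cancel₀ Complex.I_ne_zero
    rw [hk]; push_cast; ring
  have hk'' := Complex.ofReal_injective hk'
  field_simp
  linear_combination hk''

lemma labelFun_nonneg_of_im_nonneg {N p : ℕ} (hpN : p < N) {u : ℂ} (hu : 0 ≤ u.im) :
    0 ≤ labelFun N p u := by
  have hπ := Real.pi_pos
  have h3 : (0 : ℝ) < (N : ℝ) - p := by rw [sub_pos]; exact_mod_cast hpN
  have h1 : 0 ≤ (u - 1).arg := Complex.arg_nonneg_iff.2 (by simpa using hu)
  have h2 : 0 ≤ (u + 1).arg := Complex.arg_nonneg_iff.2 (by simpa using hu)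
  unfold labelFun; positivity

lemma labelFun_neg_of_im_neg {N p : ℕ} (hpN : p < N) {u : ℂ} (hu : u.im < 0) :
    labelFun N p u < 0 := by
  have hπ := Real.pi_pos
  have h3 : (0 : ℝ) < (N : ℝ) - p := by rw [sub_pos]; exact_mod_cast hpN
  have h1 : (u - 1).arg < 0 := Complex.arg_neg_iff.2 (by simpa using hu)
  have h2 : (u + 1).arg < 0 := Complex.arg_neg_iff.2 (by simpa using hu)
  unfold labelFun
  have k1 : (p : ℝ) / Real.pi * (u - 1).arg ≤ 0 :=
    mul_nonpos_of_nonneg_of_nonpos (by positivity) h1.le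
  have k2 : ((N : ℝ) - p) / Real.pi * (u + 1).arg < 0 := mul_neg_of_pos_of_neg (by positivity) h2
  linarith

lemma labelFun_pos_of_im_pos {N p : ℕ} (hpN : p < N) {u : ℂ} (hu : 0 < u.im) :
    0 < labelFun N p u := by
  have h := labelFun_neg_of_im_neg hpN (u := (starRingEnd ℂ) u) (by simpa using hu)
  rw [labelFun_conj hu.ne'] at h
  linarith

/-- On the real axis the label vanishes to the right of `1` and is at least `p` to the left. -/
lemma labelFun_of_im_zero {N p : ℕ} (hpN : p < N) {u : ℂ} (hu : u.im = 0) :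
    (1 ≤ u.re ∧ labelFun N p u = 0) ∨ (p : ℝ) ≤ labelFun N p u := by
  have hπ := Real.pi_pos
  rcases le_or_gt 1 u.re with h | h
  · left
    refine ⟨h, ?_⟩
    have h1 : (u - 1).arg = 0 := Complex.arg_eq_zero_iff.2 ⟨by simpa using h, by simpa using hu⟩
    have h2 : (u + 1).arg = 0 := Complex.arg_eq_zero_iff.2
      ⟨by simp; linarith, by simpa using hu⟩
    rw [labelFun, h1, h2]; simp
  · right
    have h1 : (u - 1).arg = Real.pi := Complex.arg_eq_pi_iff.2 ⟨by simpa using h, by simpa using hu⟩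
    have h2 : 0 ≤ (u + 1).arg := Complex.arg_nonneg_iff.2 (by simp [hu])
    have h3 : (0 : ℝ) < (N : ℝ) - p := by rw [sub_pos]; exact_mod_cast hpN
    rw [labelFun, h1, div_mul_cancel₀ _ hπ.ne']
    have : 0 ≤ ((N : ℝ) - p) / Real.pi * (u + 1).arg := by positivity
    linarith

/-- Labels are negative below the real axis, and on it they are 0 or at least p. -/
lemma im_pos_of_labelFun {N p : ℕ} (hpN : p < N) {u : ℂ} (h0 : 0 < labelFun N p u)
    (hp : labelFun N p u < p) : 0 < u.im := by
  by_contra! hle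
  rcases hle.lt_or_eq with h | h
  · linarith [labelFun_neg_of_im_neg hpN h]
  · rcases labelFun_of_im_zero hpN h with h' | h' <;> linarith

lemma im_neg_of_labelFun {N p : ℕ} (hpN : p < N) {u : ℂ} (h0 : labelFun N p u < 0) :
    u.im < 0 := by
  by_contra! h
  linarith [labelFun_nonneg_of_im_nonneg (p := p) hpN h]

/-- The angle on the level curve that belongs to a label. -/
def labelAngle (N : ℕ) (x : ℝ) : ℝ := Real.pi * x / N

lemma labelAngle_pos {N : ℕ} (hN : 0 < N) {x : ℝ} (hx : 0 < x) : 0 < labelAngle N x := by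
  have := Real.pi_pos
  have hN' : (0 : ℝ) < N := by exact_mod_cast hN
  unfold labelAngle; positivity

lemma labelAngle_lt {ρ : ℝ} {N p : ℕ} (hN : 0 < N) (hp : (p : ℝ) = ρ * N) {x : ℝ} (hx : x < p) :
    labelAngle N x < ρ * Real.pi := by
  have := Real.pi_pos
  have hN' : (0 : ℝ) < N := by exact_mod_cast hN
  rw [labelAngle, div_lt_iff₀ hN', mul_right_comm, ← hp, mul_comm]
  gcongr

lemma eq_levelPoint_of_isBetheRoot {ρ r δ : ℝ} {N p : ℕ} (hρ0 : 0 < ρ) (hρ1 : ρ < 1)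
    (hN : 0 < N) (hp : (p : ℝ) = ρ * N) (hr : 0 < r) {u : ℂ}
    (h : IsBetheRoot N p ((r : ℂ) ^ p * Complex.exp (δ * Complex.I)) u)
    (hF0 : 0 < labelFun N p u) (hFp : labelFun N p u < p) :
    u = levelPoint ρ r (labelAngle N (labelFun N p u)) := by
  have hpN := lt_of_density hρ1 hN hp
  have hu := im_pos_of_labelFun hpN hF0 hFp
  have hN' : (0 : ℝ) < N := by exact_mod_cast hN
  have hπ := Real.pi_pos
  apply eq_levelPoint hρ0 hρ1 hu
  apply Complex.ext
  · rw [levelValue_re, (h.logLevel_re_eq hN hpN hp (pos_of_density hρ0 hN hp) hr).2.2]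
  · rw [levelValue_im, labelAngle, labelFun_eq_of_im_pos hp hu]
    field_simp
    ring

lemma isBetheRoot_levelPoint {ρ r x : ℝ} {N p : ℕ} (hρ0 : 0 < ρ) (hρ1 : ρ < 1)
    (hN : 0 < N) (hp : (p : ℝ) = ρ * N) (hr : 0 < r) (hx0 : 0 < x) (hxp : x < p) :
    labelFun N p (levelPoint ρ r (labelAngle N x)) = x ∧
    ∀ δ : ℝ, (∃ k : ℤ, Real.pi * (x - p) = δ + 2 * Real.pi * k) →
      IsBetheRoot N p ((r : ℂ) ^ p * Complex.exp (δ * Complex.I))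
        (levelPoint ρ r (labelAngle N x)) := by
  have hpN := lt_of_density hρ1 hN hp
  have hN' : (0 : ℝ) < N := by exact_mod_cast hN
  have hπ := Real.pi_pos
  obtain ⟨hu, hW⟩ := levelPoint_spec hρ0 hρ1 hr (labelAngle_pos hN hx0) (labelAngle_lt hN hp hxp)
  constructor
  · rw [labelFun_eq_of_im_pos hp hu, hW, levelValue_im, labelAngle]
    field_simp
    ring
  · rintro δ ⟨k, hk⟩
    unfold IsBetheRoot
    rw [← exp_mul_logLevel hpN hp (one_sub_ne_zero_of_im_pos hu) (one_add_ne_zero_of_im_pos hu),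
      hW]
    have e : (N : ℂ) * levelValue ρ r (labelAngle N x)
        = p * Complex.log r + δ * Complex.I + k * (2 * Real.pi * Complex.I) := by
      have hk' : Real.pi * x - ρ * N * Real.pi = δ + 2 * Real.pi * k := by
        rw [← hk, ← hp]; ring
      have hA : (N : ℝ) * (labelAngle N x - ρ * Real.pi) = δ + 2 * Real.pi * k := by
        rw [← hk', labelAngle]; field_simp
      have hA' := congrArg (fun x : ℝ => (x : ℂ)) hA
      have hp' : (p : ℂ) = ρ * N := by exact_mod_cast congrArg (fun x : ℝ => (x : ℂ)) hp
      rw [levelValue, hp', ← Complex.ofReal_log hr.le]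
      push_cast at hA' ⊢
      linear_combination Complex.I * hA'
    rw [e, Complex.exp_add, Complex.exp_int_mul_two_pi_mul_I, mul_one, Complex.exp_add,
      Complex.exp_nat_mul, Complex.exp_log (by exact_mod_cast hr.ne')]

/-- Labels of roots are known modulo 2 and the interval is half open of length 2. So once some root
carries this label, whichever root is chosen must carry the same one. -/
lemma slitRoot_spec {r δ : ℝ} {N p j : ℕ} (hpN : p < N) (hr : 0 < r) (hj1 : 1 ≤ j) (hjp : j ≤ p)
    (hδ : δ ∈ Set.Ioo (-(2 * Real.pi)) 0) {v : ℂ}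
    (hv : IsBetheRoot N p ((r : ℂ) ^ p * Complex.exp (δ * Complex.I)) v)
    (hF : labelFun N p v = 2 * j - p + δ / Real.pi) :
    IsBetheRoot N p ((r : ℂ) ^ p * Complex.exp (δ * Complex.I))
        (slitRoot N p j ((r : ℂ) ^ p * Complex.exp (δ * Complex.I))) ∧
      labelFun N p (slitRoot N p j ((r : ℂ) ^ p * Complex.exp (δ * Complex.I)))
        = 2 * j - p + δ / Real.pi := by
  have hπ := Real.pi_pos
  have d1 : -2 < δ / Real.pi := by rw [lt_div_iff₀ hπ]; linarith [hδ.1]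
  have d2 : δ / Real.pi < 0 := div_neg_of_neg_of_pos hδ.2 hπ
  have hmem : labelFun N p v ∈ labelInterval N p j := by
    rw [mem_labelInterval_iff hpN hj1 hjp, hF]
    constructor <;> linarith
  obtain ⟨s1, s2⟩ := Classical.epsilon_spec
    (p := fun u : ℂ => IsBetheRoot N p ((r : ℂ) ^ p * Complex.exp (δ * Complex.I)) u ∧
      labelFun N p u ∈ labelInterval N p j) ⟨v, hv, hmem⟩
  refine ⟨s1, ?_⟩
  obtain ⟨k, hk⟩ := s1.labelFun_eq hpN hr
  rw [mem_labelInterval_iff hpN hj1 hjp, hk] at s2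
  have k1 : (k : ℝ) < j + 1 := by linarith [s2.2]
  have k2 : (j : ℝ) - 1 < k := by linarith [s2.1]
  have hkj : k = j := by
    have a1 : k < (j : ℤ) + 1 := by exact_mod_cast k1
    have a2 : (j : ℤ) - 1 < k := by exact_mod_cast k2
    omega
  rw [hkj] at hk
  refine hk.trans ?_
  push_cast; ring

lemma conj_pow_mul_exp (r δ : ℝ) (p : ℕ) :
    (starRingEnd ℂ) ((r : ℂ) ^ p * Complex.exp (δ * Complex.I))
      = (r : ℂ) ^ p * Complex.exp ((-δ : ℝ) * Complex.I) := by
  rw [map_mul, map_pow, Complex.conj_ofReal, ← Complex.exp_conj, map_mul, Complex.conj_ofReal,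
    Complex.conj_I]
  push_cast
  rw [mul_neg, neg_mul]

section Roots

variable {ρ r δ : ℝ} {N p j : ℕ}

lemma slitRoot_eq_levelPoint (hρ0 : 0 < ρ) (hρ1 : ρ < 1) (hN : 0 < N) (hp : (p : ℝ) = ρ * N)
    (hr : 0 < r) (hj1 : 1 ≤ j) (hjp : j ≤ p) (hδ : δ ∈ Set.Ioo (-(2 * Real.pi)) 0)
    (hF : 0 < 2 * (j : ℝ) - p + δ / Real.pi) :
    slitRoot N p j ((r : ℂ) ^ p * Complex.exp (δ * Complex.I))
      = levelPoint ρ r (labelAngle N (2 * j - p + δ / Real.pi)) := by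
  have hπ := Real.pi_pos
  have hpN := lt_of_density hρ1 hN hp
  have hjp' : (j : ℝ) ≤ p := by exact_mod_cast hjp
  have d2 : δ / Real.pi < 0 := div_neg_of_neg_of_pos hδ.2 hπ
  have hFp : 2 * (j : ℝ) - p + δ / Real.pi < p := by linarith
  obtain ⟨h1, h2⟩ := isBetheRoot_levelPoint hρ0 hρ1 hN hp hr hF hFp
  obtain ⟨s1, s2⟩ := slitRoot_spec hpN hr hj1 hjp hδ
    (h2 δ ⟨(j : ℤ) - p, by push_cast; field_simp; ring⟩) h1
  have := eq_levelPoint_of_isBetheRoot hρ0 hρ1 hN hp hr s1 (by rwa [s2]) (by rwa [s2])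
  rwa [s2] at this

/-- Conjugation negates both δ and the label, which reduces the claim to the upper half plane. -/
lemma slitRoot_eq_conj_levelPoint (hρ0 : 0 < ρ) (hρ1 : ρ < 1) (hN : 0 < N)
    (hp : (p : ℝ) = ρ * N) (hr : 0 < r) (hj1 : 1 ≤ j) (hjp : j ≤ p)
    (hδ : δ ∈ Set.Ioo (-(2 * Real.pi)) 0) (hF : 2 * (j : ℝ) - p + δ / Real.pi < 0) :
    slitRoot N p j ((r : ℂ) ^ p * Complex.exp (δ * Complex.I))
      = (starRingEnd ℂ) (levelPoint ρ r (labelAngle N (p - 2 * j - δ / Real.pi))) := by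
  have hπ := Real.pi_pos
  have hpN := lt_of_density hρ1 hN hp
  have hj1' : (1 : ℝ) ≤ j := by exact_mod_cast hj1
  have d1 : -2 < δ / Real.pi := by rw [lt_div_iff₀ hπ]; linarith [hδ.1]
  have hx0 : 0 < (p : ℝ) - 2 * j - δ / Real.pi := by linarith
  have hxp : (p : ℝ) - 2 * j - δ / Real.pi < p := by linarith
  obtain ⟨h1, h2⟩ := isBetheRoot_levelPoint hρ0 hρ1 hN hp hr hx0 hxp
  have him := im_pos_of_labelFun hpN (by rwa [h1]) (by rwa [h1])
  have h3 := (h2 (-δ) ⟨-(j : ℤ), by push_cast; field_simp; ring⟩).conj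
  rw [conj_pow_mul_exp, neg_neg] at h3
  obtain ⟨s1, s2⟩ := slitRoot_spec hpN hr hj1 hjp hδ h3
    (by rw [labelFun_conj him.ne', h1]; ring)
  have sim := im_neg_of_labelFun hpN (by rwa [s2])
  have s3 := s1.conj
  rw [conj_pow_mul_exp] at s3
  have e : labelFun N p ((starRingEnd ℂ)
      (slitRoot N p j ((r : ℂ) ^ p * Complex.exp (δ * Complex.I))))
      = p - 2 * j - δ / Real.pi := by
    rw [labelFun_conj sim.ne, s2]; ring
  have := eq_levelPoint_of_isBetheRoot hρ0 hρ1 hN hp hr s3 (by rwa [e]) (by rwa [e])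
  rw [e] at this
  rw [← this, Complex.conj_conj]

lemma exists_real_root (N : ℕ) (hp0 : 0 < p) (hr : 0 < r) :
    ∃ x : ℝ, 1 ≤ x ∧ (x - 1) ^ p * (1 + x) ^ (N - p) = r ^ p := by
  have hc : ContinuousOn (fun x : ℝ => (x - 1) ^ p * (1 + x) ^ (N - p)) (Set.Icc 1 (1 + r)) := by
    fun_prop
  have := intermediate_value_Icc (by linarith : (1 : ℝ) ≤ 1 + r) hc
  obtain ⟨x, hx, hx'⟩ := this (show r ^ p ∈ _ from ⟨by simp [hp0.ne']; positivity, by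
    simp only [add_sub_cancel_left]
    exact le_mul_of_one_le_right (by positivity) (one_le_pow₀ (by linarith))⟩)
  exact ⟨x, hx.1, hx'⟩

/-- The label 0 belongs to no point off the real axis, and on the axis it forces u ≥ 1. Oddness of p
makes the real solution x ≥ 1 a root for the sign e^(-iπ), so the label is attained. Bounds suffice,
as this is a single term of the sum. -/
lemma slitRoot_middle_bounds {R : ℝ} (hρ0 : 0 < ρ) (hρ1 : ρ < 1) (hN : 0 < N)
    (hp : (p : ℝ) = ρ * N) (hr : 0 < r) (hrR : r ≤ R) (hR : 1 ≤ R) (hj : 2 * j = p + 1) :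
    ‖slitRoot N p j ((r : ℂ) ^ p * Complex.exp ((-Real.pi : ℝ) * Complex.I))‖ ≤ 1 + R ∧
    distBound ρ ≤
      ‖1 + slitRoot N p j ((r : ℂ) ^ p * Complex.exp ((-Real.pi : ℝ) * Complex.I))‖ := by
  have hπ := Real.pi_pos
  have hpN := lt_of_density hρ1 hN hp
  have hp0 := pos_of_density hρ0 hN hp
  obtain ⟨x, hx, hxr⟩ := exists_real_root N hp0 hr
  have hodd : Odd p := ⟨j - 1, by omega⟩
  have hroot : IsBetheRoot N p ((r : ℂ) ^ p * Complex.exp ((-Real.pi : ℝ) * Complex.I)) (x : ℂ) := by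
    unfold IsBetheRoot
    have e : Complex.exp ((-Real.pi : ℝ) * Complex.I) = -1 := by
      push_cast; rw [neg_mul, Complex.exp_neg, Complex.exp_pi_mul_I]; norm_num
    have e2 : (1 - x : ℂ) = -(x - 1) := by ring
    rw [e, e2, hodd.neg_pow]
    have := congrArg (fun x : ℝ => (x : ℂ)) hxr
    push_cast at this
    rw [← this]; ring
  have hjR : 2 * (j : ℝ) = p + 1 := by exact_mod_cast hj
  have hF : 2 * (j : ℝ) - p + -Real.pi / Real.pi = 0 := by
    rw [neg_div, div_self hπ.ne']; linarith
  have hlab : labelFun N p (x : ℂ) = 0 := by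
    have e1 : ((x : ℂ) - 1).arg = 0 := by
      rw [← Complex.ofReal_one, ← Complex.ofReal_sub]
      exact Complex.arg_ofReal_of_nonneg (by linarith)
    have e2 : ((x : ℂ) + 1).arg = 0 := by
      rw [← Complex.ofReal_one, ← Complex.ofReal_add]
      exact Complex.arg_ofReal_of_nonneg (by linarith)
    rw [labelFun, e1, e2]; simp
  have hj1 : 1 ≤ j := by omega
  have hjp : j ≤ p := by omega
  obtain ⟨s1, s2⟩ := slitRoot_spec hpN hr hj1 hjp
    (⟨by linarith, by linarith⟩ : -Real.pi ∈ Set.Ioo (-(2 * Real.pi)) 0) hroot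
    (by rw [hlab, hF])
  rw [hF] at s2
  set u := slitRoot N p j ((r : ℂ) ^ p * Complex.exp ((-Real.pi : ℝ) * Complex.I))
  refine ⟨norm_le_of_logLevel_re hρ0 hρ1 hr hrR hR
    (s1.logLevel_re_eq hN hpN hp hp0 hr).2.2, ?_⟩
  have him : u.im = 0 := by
    rcases lt_trichotomy u.im 0 with h | h | h
    · linarith [labelFun_neg_of_im_neg hpN h]
    · exact h
    · linarith [labelFun_pos_of_im_pos hpN h]
  have hre : 1 ≤ u.re := by
    rcases labelFun_of_im_zero hpN him with h | h
    · exact h.1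
    · rw [s2] at h
      have : (0 : ℝ) < p := by exact_mod_cast hp0
      linarith
  have h1 : distBound ρ ≤ 1 := min_le_left _ _
  have h2 := Complex.re_le_norm (1 + u)
  simp at h2
  linarith

end Roots

/-! ### Convergence of the curve at its real ends -/

lemma exists_tendsto_levelPoint_of_real_end {ρ r R : ℝ} (hρ0 : 0 < ρ) (hρ1 : ρ < 1) (hr : 0 < r)
    (hrR : r ≤ R) (hR : 1 ≤ R) {l : Filter ℝ} [l.NeBot]
    (hmem : ∀ᶠ ψ in l, ψ ∈ Set.Ioo 0 (ρ * Real.pi)) {x : ℝ}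
    (hre : Tendsto (fun ψ => (levelPoint ρ r ψ).re) l (𝓝 x))
    (him : Tendsto (fun ψ => (levelPoint ρ r ψ).im) l (𝓝 0)) :
    Tendsto (levelPoint ρ r) l (𝓝 (x : ℂ)) ∧ ‖(x : ℂ)‖ ≤ 1 + R ∧
      distBound ρ ≤ ‖1 + (x : ℂ)‖ := by
  have ht : Tendsto (levelPoint ρ r) l (𝓝 (x : ℂ)) := by
    have h1 := ((Complex.continuous_ofReal.tendsto x).comp hre).add
      (((Complex.continuous_ofReal.tendsto 0).comp him).mul_const Complex.I)
    simpa [Function.comp_def] using h1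
  have hb := hmem.mono fun ψ hψ => levelPoint_bounds hρ0 hρ1 hr hrR hR hψ.1 hψ.2
  exact ⟨ht, le_of_tendsto ht.norm (hb.mono fun ψ h => h.1),
    ge_of_tendsto (ht.const_add 1).norm (hb.mono fun ψ h => h.2)⟩

lemma abs_re_levelPoint_le {ρ r R ψ : ℝ} (hρ0 : 0 < ρ) (hρ1 : ρ < 1) (hr : 0 < r) (hrR : r ≤ R)
    (hR : 1 ≤ R) (hψ : ψ ∈ Set.Ioo 0 (ρ * Real.pi)) : |(levelPoint ρ r ψ).re| ≤ 1 + R :=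
  (Complex.abs_re_le_norm _).trans (levelPoint_bounds hρ0 hρ1 hr hrR hR hψ.1 hψ.2).1

/-- Re u is monotone and bounded along the curve and Im u tends to 0. The value of the limit is
irrelevant; only the bounds pass on. -/
lemma exists_tendsto_levelPoint_zero {ρ r R : ℝ} (hρ0 : 0 < ρ) (hρ1 : ρ < 1) (hr : 0 < r)
    (hrR : r ≤ R) (hR : 1 ≤ R) :
    ∃ x : ℝ, Tendsto (levelPoint ρ r) (𝓝[>] 0) (𝓝 (x : ℂ)) ∧ ‖(x : ℂ)‖ ≤ 1 + R ∧
      distBound ρ ≤ ‖1 + (x : ℂ)‖ := by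
  have hπ : 0 < ρ * Real.pi := by have := Real.pi_pos; positivity
  have hev : ∀ᶠ ψ in 𝓝[>] (0 : ℝ), ψ ∈ Set.Ioo 0 (ρ * Real.pi) := Ioo_mem_nhdsGT hπ
  have hmono := (antitoneOn_re_levelPoint hρ0 hρ1 hr).neg
  have hbdd : BddBelow ((fun ψ => -(levelPoint ρ r ψ).re) '' Set.Ioo 0 (ρ * Real.pi)) := by
    refine ⟨-(1 + R), ?_⟩
    rintro _ ⟨ψ, hψ, rfl⟩
    have := abs_le.1 (abs_re_levelPoint_le hρ0 hρ1 hr hrR hR hψ)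
    simp only; linarith
  have ht := (hmono.tendsto_nhdsWithin_Ioo_right (Set.nonempty_Ioo.2 hπ) hbdd).neg
  refine ⟨_, exists_tendsto_levelPoint_of_real_end hρ0 hρ1 hr hrR hR hev
    (x := -sInf ((fun ψ => -(levelPoint ρ r ψ).re) '' Set.Ioo 0 (ρ * Real.pi))) (by simpa using ht)
    (tendsto_real_end hρ0 hρ1 hr nhdsWithin_le_nhds hev
      (tendsto_arg_levelPoint_zero hρ0 hρ1 hr)).1⟩

lemma exists_tendsto_levelPoint_crit {ρ r R : ℝ} (hρ0 : 0 < ρ) (hρ1 : ρ < 1) (hr : 0 < r)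
    (hrc : r ≤ rCrit ρ) (hrR : r ≤ R) (hR : 1 ≤ R) :
    ∃ x : ℝ, Tendsto (levelPoint ρ r) (𝓝[<] (ρ * Real.pi)) (𝓝 (x : ℂ)) ∧ ‖(x : ℂ)‖ ≤ 1 + R ∧
      distBound ρ ≤ ‖1 + (x : ℂ)‖ := by
  have hπ : 0 < ρ * Real.pi := by have := Real.pi_pos; positivity
  have hev : ∀ᶠ ψ in 𝓝[<] (ρ * Real.pi), ψ ∈ Set.Ioo 0 (ρ * Real.pi) := Ioo_mem_nhdsLT hπ
  have hmono := (antitoneOn_re_levelPoint hρ0 hρ1 hr).neg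
  have hbdd : BddAbove ((fun ψ => -(levelPoint ρ r ψ).re) '' Set.Ioo 0 (ρ * Real.pi)) := by
    refine ⟨1 + R, ?_⟩
    rintro _ ⟨ψ, hψ, rfl⟩
    have := abs_le.1 (abs_re_levelPoint_le hρ0 hρ1 hr hrR hR hψ)
    simp only; linarith
  have ht := (hmono.tendsto_nhdsWithin_Ioo_left (Set.nonempty_Ioo.2 hπ) hbdd).neg
  refine ⟨_, exists_tendsto_levelPoint_of_real_end hρ0 hρ1 hr hrR hR hev
    (x := -sSup ((fun ψ => -(levelPoint ρ r ψ).re) '' Set.Ioo 0 (ρ * Real.pi))) (by simpa using ht)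
    (tendsto_real_end hρ0 hρ1 hr nhdsWithin_le_nhds hev
      (tendsto_arg_levelPoint_crit hρ0 hρ1 hr hrc)).1⟩

/-! ### The roots for real parameter, and their sums -/

section Labels

variable {ρ r R C : ℝ} {N p : ℕ}

lemma pow_of_eq_rpow (hp0 : 0 < p) (hr : r = |C| ^ (1 / (p : ℝ))) : r ^ p = |C| := by
  rw [hr, one_div, Real.rpow_inv_natCast_pow (abs_nonneg _) hp0.ne']

lemma betheRoot_of_neg (hp0 : 0 < p) (hC : C < 0) (hr : r = |C| ^ (1 / (p : ℝ))) (j : ℕ) :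
    betheRoot N p j C
      = slitRoot N p j ((r : ℂ) ^ p * Complex.exp ((-Real.pi : ℝ) * Complex.I)) := by
  have hC' : (C : ℂ) = (r : ℂ) ^ p * Complex.exp ((-Real.pi : ℝ) * Complex.I) := by
    have e : Complex.exp ((-Real.pi : ℝ) * Complex.I) = -1 := by
      push_cast; rw [neg_mul, Complex.exp_neg, Complex.exp_pi_mul_I]; norm_num
    rw [e, ← Complex.ofReal_pow, pow_of_eq_rpow hp0 hr, abs_of_neg hC]
    push_cast; ring
  have hC0 : (C : ℂ) ≠ 0 := by exact_mod_cast hC.ne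
  rw [betheRoot, if_neg hC0, if_neg, hC']
  rintro ⟨-, h⟩
  rw [Complex.ofReal_re] at h
  linarith

lemma betheRoot_of_pos (hp0 : 0 < p) (hC : 0 < C) (hr : r = |C| ^ (1 / (p : ℝ))) (j : ℕ) {w : ℂ}
    (hw : Tendsto (fun δ : ℝ => slitRoot N p j ((r : ℂ) ^ p * Complex.exp (δ * Complex.I)))
      (𝓝[<] 0) (𝓝 w)) : betheRoot N p j C = w := by
  have hC' : (C : ℂ) = (r : ℂ) ^ p := by
    rw [← Complex.ofReal_pow, pow_of_eq_rpow hp0 hr, abs_of_pos hC]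
  have hC0 : (C : ℂ) ≠ 0 := by exact_mod_cast hC.ne'
  rw [betheRoot, if_neg hC0, if_pos ⟨Complex.ofReal_im C, by simpa using hC⟩, hC']
  exact hw.limUnder_eq

/-- The description of the roots `u_j(C)` for negative `C` through the level curve. -/
lemma betheRoot_labels_of_neg (hρ0 : 0 < ρ) (hρ1 : ρ < 1) (hN : 0 < N) (hp : (p : ℝ) = ρ * N)
    (hC : C < 0) (hr : r = |C| ^ (1 / (p : ℝ))) (hr0 : 0 < r) (hrR : r ≤ R) (hR : 1 ≤ R) {j : ℕ}
    (hj1 : 1 ≤ j) (hjp : j ≤ p) :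
    (p + 1 < 2 * j → betheRoot N p j C = levelPoint ρ r (labelAngle N (2 * j - (p + 1 : ℕ)))) ∧
    (2 * j < p + 1 → betheRoot N p j C
      = (starRingEnd ℂ) (levelPoint ρ r (labelAngle N ((p + 1 : ℕ) - 2 * j)))) ∧
    ‖betheRoot N p j C‖ ≤ 1 + R ∧ distBound ρ ≤ ‖1 + betheRoot N p j C‖ := by
  have hπ := Real.pi_pos
  have hp0 := pos_of_density hρ0 hN hp
  have hδ : -Real.pi ∈ Set.Ioo (-(2 * Real.pi)) 0 := ⟨by linarith, by linarith⟩
  have hdiv : -Real.pi / Real.pi = -1 := by rw [neg_div, div_self hπ.ne']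
  have hj1' : (1 : ℝ) ≤ j := by exact_mod_cast hj1
  have hjp' : (j : ℝ) ≤ p := by exact_mod_cast hjp
  rw [betheRoot_of_neg hp0 hC hr]
  have hpos : p + 1 < 2 * j →
      slitRoot N p j ((r : ℂ) ^ p * Complex.exp ((-Real.pi : ℝ) * Complex.I))
        = levelPoint ρ r (labelAngle N (2 * j - (p + 1 : ℕ))) := by
    intro h
    have h' : (p : ℝ) + 1 < 2 * j := by exact_mod_cast h
    rw [slitRoot_eq_levelPoint hρ0 hρ1 hN hp hr0 hj1 hjp hδ (by rw [hdiv]; linarith), hdiv]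
    congr 2; push_cast; ring
  have hneg : 2 * j < p + 1 →
      slitRoot N p j ((r : ℂ) ^ p * Complex.exp ((-Real.pi : ℝ) * Complex.I))
        = (starRingEnd ℂ) (levelPoint ρ r (labelAngle N ((p + 1 : ℕ) - 2 * j))) := by
    intro h
    have h' : 2 * (j : ℝ) < p + 1 := by exact_mod_cast h
    rw [slitRoot_eq_conj_levelPoint hρ0 hρ1 hN hp hr0 hj1 hjp hδ (by rw [hdiv]; linarith), hdiv]
    congr 3; push_cast; ring
  refine ⟨hpos, hneg, ?_⟩
  rcases lt_trichotomy (2 * j) (p + 1) with h | h | h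
  · have h' : 2 * (j : ℝ) < p + 1 := by exact_mod_cast h
    have hb := levelPoint_bounds hρ0 hρ1 hr0 hrR hR
      (labelAngle_pos hN (x := (p + 1 : ℕ) - 2 * j) (by push_cast; linarith))
      (labelAngle_lt hN hp (by push_cast; linarith))
    rw [hneg h, Complex.norm_conj]
    refine ⟨hb.1, ?_⟩
    rw [← Complex.norm_conj, map_add, Complex.conj_conj, map_one]
    exact hb.2
  · exact slitRoot_middle_bounds hρ0 hρ1 hN hp hr0 hrR hR h
  · have h' : (p : ℝ) + 1 < 2 * j := by exact_mod_cast h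
    rw [hpos h]
    exact levelPoint_bounds hρ0 hρ1 hr0 hrR hR
      (labelAngle_pos hN (x := 2 * j - (p + 1 : ℕ)) (by push_cast; linarith))
      (labelAngle_lt hN hp (by push_cast; linarith))

lemma continuous_labelAngle (N : ℕ) : Continuous (labelAngle N) := by
  unfold labelAngle; fun_prop

lemma tendsto_levelPoint_of_Ioo (hρ0 : 0 < ρ) (hρ1 : ρ < 1) (hr0 : 0 < r) {ψ : ℝ}
    (hψ : ψ ∈ Set.Ioo 0 (ρ * Real.pi)) :
    Tendsto (levelPoint ρ r) (𝓝 ψ) (𝓝 (levelPoint ρ r ψ)) :=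
  (hasDerivAt_levelPoint hρ0 hρ1 hr0 hψ.1 hψ.2).continuousAt

/-- The description of the roots `u_j(C)` for positive `C` through the level curve. -/
lemma betheRoot_labels_of_pos (hρ0 : 0 < ρ) (hρ1 : ρ < 1) (hN : 0 < N) (hp : (p : ℝ) = ρ * N)
    (hC : 0 < C) (hr : r = |C| ^ (1 / (p : ℝ))) (hr0 : 0 < r) (hrc : r ≤ rCrit ρ) (hrR : r ≤ R)
    (hR : 1 ≤ R) {j : ℕ} (hj1 : 1 ≤ j) (hjp : j ≤ p) :
    (j < p → p < 2 * j → betheRoot N p j C = levelPoint ρ r (labelAngle N (2 * j - p))) ∧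
    (2 * j < p → betheRoot N p j C
      = (starRingEnd ℂ) (levelPoint ρ r (labelAngle N (p - 2 * j)))) ∧
    ‖betheRoot N p j C‖ ≤ 1 + R ∧ distBound ρ ≤ ‖1 + betheRoot N p j C‖ := by
  have hπ := Real.pi_pos
  have hN' : (0 : ℝ) < N := by exact_mod_cast hN
  have hp0 := pos_of_density hρ0 hN hp
  have hp0' : (0 : ℝ) < p := by exact_mod_cast hp0
  have hj1' : (1 : ℝ) ≤ j := by exact_mod_cast hj1
  have hδ : ∀ᶠ δ in 𝓝[<] (0 : ℝ), δ ∈ Set.Ioo (-(2 * Real.pi)) 0 := Ioo_mem_nhdsLT (by linarith)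
  have hlim : ∀ c : ℝ, Tendsto (fun δ : ℝ => c + δ / Real.pi) (𝓝[<] 0) (𝓝 c) := by
    intro c
    have : Tendsto (fun δ : ℝ => c + δ / Real.pi) (𝓝 0) (𝓝 (c + 0 / Real.pi)) :=
      (Continuous.tendsto (by fun_prop) 0)
    rw [zero_div, add_zero] at this
    exact this.mono_left nhdsWithin_le_nhds
  have hup : p < 2 * j → ∀ᶠ δ : ℝ in 𝓝[<] 0, levelPoint ρ r (labelAngle N (2 * j - p + δ / Real.pi))
      = slitRoot N p j ((r : ℂ) ^ p * Complex.exp (δ * Complex.I)) := by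
    intro h
    have h' : (0 : ℝ) < 2 * j - p := by rw [sub_pos]; exact_mod_cast h
    filter_upwards [hδ, (hlim _).eventually (lt_mem_nhds h')] with δ hδ hF
    exact (slitRoot_eq_levelPoint hρ0 hρ1 hN hp hr0 hj1 hjp hδ hF).symm
  have hdown : 2 * j ≤ p → ∀ᶠ δ : ℝ in 𝓝[<] 0,
      (starRingEnd ℂ) (levelPoint ρ r (labelAngle N (-(2 * j - p + δ / Real.pi))))
      = slitRoot N p j ((r : ℂ) ^ p * Complex.exp (δ * Complex.I)) := by
    intro h
    have h' : 2 * (j : ℝ) ≤ p := by exact_mod_cast h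
    filter_upwards [hδ] with δ hδ
    have d2 : δ / Real.pi < 0 := div_neg_of_neg_of_pos hδ.2 hπ
    rw [slitRoot_eq_conj_levelPoint hρ0 hρ1 hN hp hr0 hj1 hjp hδ (by linarith)]
    congr 3; ring
  have hpos : j < p → p < 2 * j → betheRoot N p j C = levelPoint ρ r (labelAngle N (2 * j - p)) := by
    intro h1 h2
    have h1' : (j : ℝ) < p := by exact_mod_cast h1
    have h2' : (p : ℝ) < 2 * j := by exact_mod_cast h2
    have ht := (tendsto_levelPoint_of_Ioo hρ0 hρ1 hr0
      ⟨labelAngle_pos hN (x := 2 * j - p) (by linarith), labelAngle_lt hN hp (by linarith)⟩).comp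
      (((continuous_labelAngle N).tendsto _).comp (hlim (2 * j - p)))
    exact betheRoot_of_pos hp0 hC hr j (ht.congr' (hup h2))
  have hneg : 2 * j < p → betheRoot N p j C
      = (starRingEnd ℂ) (levelPoint ρ r (labelAngle N (p - 2 * j))) := by
    intro h
    have h' : 2 * (j : ℝ) < p := by exact_mod_cast h
    have hl := (hlim (2 * j - p)).neg
    rw [neg_sub] at hl
    have ht := (tendsto_levelPoint_of_Ioo hρ0 hρ1 hr0
      ⟨labelAngle_pos hN (x := p - 2 * j) (by linarith), labelAngle_lt hN hp (by linarith)⟩).comp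
      (((continuous_labelAngle N).tendsto _).comp hl)
    have ht' := (Complex.continuous_conj.tendsto _).comp ht
    exact betheRoot_of_pos hp0 hC hr j (ht'.congr' (hdown h.le))
  refine ⟨hpos, hneg, ?_⟩
  rcases lt_trichotomy (2 * j) p with h | h | h
  · have h' : 2 * (j : ℝ) < p := by exact_mod_cast h
    have hb := levelPoint_bounds hρ0 hρ1 hr0 hrR hR
      (labelAngle_pos hN (x := p - 2 * j) (by linarith)) (labelAngle_lt hN hp (by linarith))
    rw [hneg h, Complex.norm_conj]
    refine ⟨hb.1, ?_⟩
    rw [← Complex.norm_conj, map_add, Complex.conj_conj, map_one]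
    exact hb.2
  · obtain ⟨x, hx, hb⟩ := exists_tendsto_levelPoint_zero hρ0 hρ1 hr0 hrR hR
    have h' : 2 * (j : ℝ) - p = 0 := by rw [sub_eq_zero]; exact_mod_cast h
    -- The root of label 0 is a limit from the lower half plane, since δ < 0 makes its label
    -- slightly negative.
    have ha : Tendsto (fun δ : ℝ => labelAngle N (-(2 * j - p + δ / Real.pi))) (𝓝[<] 0)
        (𝓝[>] 0) := by
      apply tendsto_nhdsWithin_iff.2 ⟨?_, ?_⟩
      · have := ((continuous_labelAngle N).tendsto _).comp (hlim (2 * j - p)).neg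
        have e : labelAngle N (-(2 * j - p)) = 0 := by rw [h']; simp [labelAngle]
        rw [e] at this
        exact this
      · filter_upwards [hδ] with δ hδ
        have d2 : δ / Real.pi < 0 := div_neg_of_neg_of_pos hδ.2 hπ
        exact labelAngle_pos hN (by linarith)
    have ht := (Complex.continuous_conj.tendsto _).comp (hx.comp ha)
    rw [Complex.conj_ofReal] at ht
    rw [betheRoot_of_pos hp0 hC hr j (ht.congr' (hdown h.le))]
    exact hb
  · rcases hjp.lt_or_eq with hlt | rfl
    · have h' : (p : ℝ) < 2 * j := by exact_mod_cast h
      have hlt' : (j : ℝ) < p := by exact_mod_cast hlt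
      rw [hpos hlt h]
      exact levelPoint_bounds hρ0 hρ1 hr0 hrR hR
        (labelAngle_pos hN (x := 2 * j - p) (by linarith)) (labelAngle_lt hN hp (by linarith))
    -- The label j = p runs to the end ψ = ρπ; here r ≤ r_cr ensures a real limit.
    · obtain ⟨x, hx, hb⟩ := exists_tendsto_levelPoint_crit hρ0 hρ1 hr0 hrc hrR hR
      have ha : Tendsto (fun δ : ℝ => labelAngle N (2 * j - j + δ / Real.pi)) (𝓝[<] 0)
          (𝓝[<] (ρ * Real.pi)) := by
        apply tendsto_nhdsWithin_iff.2 ⟨?_, ?_⟩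
        · have := ((continuous_labelAngle N).tendsto _).comp (hlim (2 * j - j))
          have e : labelAngle N (2 * j - j) = ρ * Real.pi := by
            rw [labelAngle, div_eq_iff hN'.ne', hp]; ring
          rw [e] at this
          exact this
        · filter_upwards [hδ] with δ hδ
          have d2 : δ / Real.pi < 0 := div_neg_of_neg_of_pos hδ.2 hπ
          exact labelAngle_lt hN hp (by linarith)
      have ht := hx.comp ha
      rw [betheRoot_of_pos hp0 hC hr j (ht.congr' (hup h))]
      exact hb

/-- A negative C is r^p e^(-iπ), which shifts all labels by -1, so q = p+1; for positive C there is
no shift. The hypothesis C ≤ r_cr^p restricts r only for positive C. -/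
lemma exists_betheRoot_labels (hρ0 : 0 < ρ) (hρ1 : ρ < 1) (hN : 0 < N) (hp : (p : ℝ) = ρ * N)
    (hC0 : C ≠ 0) (hC : C ≤ rCrit ρ ^ p) (hr : r = |C| ^ (1 / (p : ℝ))) (hrR : r ≤ R)
    (hR : 1 ≤ R) :
    ∃ q : ℕ, (q = p ∨ q = p + 1) ∧
      (∀ j, 1 ≤ j → j < q → q < 2 * j →
        betheRoot N p j C = levelPoint ρ r (labelAngle N (2 * j - q))) ∧
      (∀ j, 1 ≤ j → 2 * j < q → betheRoot N p j C
        = (starRingEnd ℂ) (levelPoint ρ r (labelAngle N (q - 2 * j)))) ∧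
      ∀ j, 1 ≤ j → j ≤ p → ‖betheRoot N p j C‖ ≤ 1 + R ∧ distBound ρ ≤ ‖1 + betheRoot N p j C‖ := by
  have hp0 := pos_of_density hρ0 hN hp
  have hr0 : 0 < r := by rw [hr]; have := abs_pos.2 hC0; positivity
  rcases hC0.lt_or_gt with hneg | hpos
  · refine ⟨p + 1, Or.inr rfl, fun j h1 h2 h3 => ?_, fun j h1 h2 => ?_, fun j h1 h2 => ?_⟩
    · exact (betheRoot_labels_of_neg hρ0 hρ1 hN hp hneg hr hr0 hrR hR h1 (by omega)).1 h3
    · exact (betheRoot_labels_of_neg hρ0 hρ1 hN hp hneg hr hr0 hrR hR h1 (by omega)).2.1 h2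
    · exact (betheRoot_labels_of_neg hρ0 hρ1 hN hp hneg hr hr0 hrR hR h1 h2).2.2
  · have hrc : r ≤ rCrit ρ := by
      have h1 := pow_of_eq_rpow hp0 hr
      rw [abs_of_pos hpos] at h1
      exact le_of_pow_le_pow_left₀ hp0.ne' (rCrit_pos hρ0 hρ1).le (h1 ▸ hC)
    refine ⟨p, Or.inl rfl, fun j h1 h2 h3 => ?_, fun j h1 h2 => ?_, fun j h1 h2 => ?_⟩
    · exact (betheRoot_labels_of_pos hρ0 hρ1 hN hp hpos hr hr0 hrc hrR hR h1 (by omega)).1 h2 h3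
    · exact (betheRoot_labels_of_pos hρ0 hρ1 hN hp hpos hr hr0 hrc hrR hR h1 (by omega)).2.1 h2
    · exact (betheRoot_labels_of_pos hρ0 hρ1 hN hp hpos hr hr0 hrc hrR hR h1 h2).2.2

/-- Sums over the roots `u_j(C)` compared with the limits of a primitive along the level curve. -/
lemma norm_sum_betheRoot_sub_le (hρ0 : 0 < ρ) (hρ1 : ρ < 1) (hN : 0 < N) (hp : (p : ℝ) = ρ * N)
    (hC0 : C ≠ 0) (hC : C ≤ rCrit ρ ^ p) (hr : r = |C| ^ (1 / (p : ℝ))) (hrR : r ≤ R)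
    (hR : 1 ≤ R) {f A : ℂ → ℂ} {M a b : ℝ}
    (hA : ∀ u : ℂ, 0 < u.im → HasDerivAt A (f u * logLevelDeriv ρ u) u)
    (hanti : AntitoneOn (fun ψ => (f (levelPoint ρ r ψ)).re) (Set.Ioo 0 (ρ * Real.pi)))
    (hconj : ∀ u : ℂ, 0 < u.im → f ((starRingEnd ℂ) u) = (starRingEnd ℂ) (f u))
    (hM : ∀ u : ℂ, ‖u‖ ≤ 1 + R → distBound ρ ≤ ‖1 + u‖ → ‖f u‖ ≤ M)
    (h0 : Tendsto (fun ψ => (A (levelPoint ρ r ψ)).im) (𝓝[>] 0) (𝓝 a))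
    (h1 : Tendsto (fun ψ => (A (levelPoint ρ r ψ)).im) (𝓝[<] (ρ * Real.pi)) (𝓝 b)) :
    ‖∑ j ∈ Finset.Icc 1 p, f (betheRoot N p j C) - ((N / Real.pi * (b - a) : ℝ) : ℂ)‖ ≤ 12 * M := by
  have hπ := Real.pi_pos
  have hN' : (0 : ℝ) < N := by exact_mod_cast hN
  have hp0 := pos_of_density hρ0 hN hp
  have hp0' : (0 : ℝ) < p := by exact_mod_cast hp0
  have hr0 : 0 < r := by rw [hr]; have := abs_pos.2 hC0; positivity
  have hmem : ∀ x ∈ Set.Ioo 0 (p : ℝ), labelAngle N x ∈ Set.Ioo 0 (ρ * Real.pi) := fun x hx =>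
    ⟨labelAngle_pos hN hx.1, labelAngle_lt hN hp hx.2⟩
  have hup : ∀ x ∈ Set.Ioo 0 (p : ℝ), 0 < (levelPoint ρ r (labelAngle N x)).im := fun x hx =>
    (levelPoint_spec hρ0 hρ1 hr0 (hmem x hx).1 (hmem x hx).2).1
  obtain ⟨q, hq, hpos, hneg, hbd⟩ := exists_betheRoot_labels hρ0 hρ1 hN hp hC0 hC hr hrR hR
  have hqp : (q : ℝ) ≤ p + 1 := by
    have : q ≤ p + 1 := by omega
    exact_mod_cast this
  have hmono : Monotone (labelAngle N) := fun x y hxy => by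
    unfold labelAngle; gcongr
  have key := norm_sum_labels_sub_le hp0 hq (M := M) (a := N / Real.pi * a) (b := N / Real.pi * b)
    (v := fun j => f (betheRoot N p j C)) (φ := fun x => f (levelPoint ρ r (labelAngle N x)))
    (h := fun x => N / Real.pi * (A (levelPoint ρ r (labelAngle N x))).im)
    (fun j h1 h2 h3 => by simp only [hpos j h1 h2 h3])
    (fun j h1 h2 => by
      have h2' : 2 * (j : ℝ) < q := by exact_mod_cast h2
      have h1' : (1 : ℝ) ≤ j := by exact_mod_cast h1
      simp only [hneg j h1 h2]
      exact hconj _ (hup _ ⟨by linarith, by linarith⟩))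
    (fun j h1 h2 => hM _ (hbd j h1 h2).1 (hbd j h1 h2).2)
    (fun x hx y hy hxy => hanti (hmem x hx) (hmem y hy) (hmono hxy))
    (fun x hx => by
      have hb := levelPoint_bounds hρ0 hρ1 hr0 hrR hR (hmem x hx).1 (hmem x hx).2
      exact (Complex.abs_re_le_norm _).trans (hM _ hb.1 hb.2))
    (fun x hx => by
      have hd := hasDerivAt_im_comp_levelPoint hρ0 hρ1 hr0 (hmem x hx).1 (hmem x hx).2
        (hA _ (hup x hx))
      have hl : HasDerivAt (labelAngle N) (Real.pi / N) x := by
        have := ((hasDerivAt_id x).const_mul Real.pi).div_const (N : ℝ)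
        rw [mul_one] at this
        exact this
      refine ((hd.comp x hl).const_mul (N / Real.pi : ℝ)).congr_deriv ?_
      field_simp)
    (by
      refine (h0.comp (tendsto_nhdsWithin_iff.2 ⟨?_, ?_⟩)).const_mul _
      · have := (continuous_labelAngle N).tendsto 0
        have e : labelAngle N 0 = 0 := by simp [labelAngle]
        rw [e] at this
        exact this.mono_left nhdsWithin_le_nhds
      · filter_upwards [self_mem_nhdsWithin] with x hx
        exact labelAngle_pos hN hx)
    (by
      refine (h1.comp (tendsto_nhdsWithin_iff.2 ⟨?_, ?_⟩)).const_mul _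
      · have := (continuous_labelAngle N).tendsto p
        have e : labelAngle N p = ρ * Real.pi := by
          rw [labelAngle, div_eq_iff hN'.ne', hp]; ring
        rw [e] at this
        exact this.mono_left nhdsWithin_le_nhds
      · filter_upwards [self_mem_nhdsWithin] with x hx
        exact labelAngle_lt hN hp hx)
  rwa [← mul_sub] at key

end Labels

/-! ### Boundary values of the primitives at the upper end -/

section Limits

variable {ρ r : ℝ}

lemma tendsto_primLambda_end (hρ0 : 0 < ρ) (hρ1 : ρ < 1) (hr : 0 < r) :
    Tendsto (fun ψ => (primLambda ρ (levelPoint ρ r ψ)).im) (𝓝[<] (ρ * Real.pi))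
      (𝓝 (2 * Real.pi * LambdaLimit ρ r)) := by
  have hπ := Real.pi_pos
  rcases lt_or_ge (rCrit ρ) r with h | h
  · have hu := (logLevel_uStar hρ0 hρ1 h).1
    have e : 2 * Real.pi * LambdaLimit ρ r = (primLambda ρ (uStar ρ r)).im := by
      rw [LambdaLimit, if_pos h, LambdaInf_eq]; field_simp
    rw [e]
    exact (Complex.continuous_im.tendsto _).comp
      ((hasDerivAt_primLambda ρ hu).continuousAt.tendsto.comp (tendsto_levelPoint_uStar hρ0 hρ1 h))
  · rw [LambdaLimit, if_neg h.not_gt, mul_zero]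
    exact (tendsto_real_end hρ0 hρ1 hr nhdsWithin_le_nhds (Ioo_mem_nhdsLT (by positivity))
      (tendsto_arg_levelPoint_crit hρ0 hρ1 hr h)).2.1

lemma tendsto_primG_end (hρ0 : 0 < ρ) (hρ1 : ρ < 1) (hr : 0 < r) :
    Tendsto (fun ψ => (primG ρ (levelPoint ρ r ψ)).im) (𝓝[<] (ρ * Real.pi))
      (𝓝 (ρ * Real.pi * GLimit ρ r)) := by
  have hπ := Real.pi_pos
  rcases lt_or_ge (rCrit ρ) r with h | h
  · have hu := (logLevel_uStar hρ0 hρ1 h).1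
    have e : ρ * Real.pi * GLimit ρ r = (primG ρ (uStar ρ r)).im := by
      rw [GLimit, if_pos h, GInf_eq hρ0]; field_simp
    rw [e]
    exact (Complex.continuous_im.tendsto _).comp
      ((hasDerivAt_primG ρ hu).continuousAt.tendsto.comp (tendsto_levelPoint_uStar hρ0 hρ1 h))
  · rw [GLimit, if_neg h.not_gt, mul_zero]
    have := (tendsto_real_end hρ0 hρ1 hr nhdsWithin_le_nhds (Ioo_mem_nhdsLT (by positivity))
      (tendsto_arg_levelPoint_crit hρ0 hρ1 hr h)).2.2
    simpa using this

end Limits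

/-! ### The two estimates for nonzero parameter, and the parameter zero -/

section Bounds

variable {ρ r R C : ℝ} {N p : ℕ}

lemma norm_GN_sub_le (hρ0 : 0 < ρ) (hρ1 : ρ < 1) (hN : 0 < N) (hp : (p : ℝ) = ρ * N)
    (hC0 : C ≠ 0) (hC : C ≤ rCrit ρ ^ p) (hr : r = |C| ^ (1 / (p : ℝ))) (hrR : r ≤ R)
    (hR : 1 ≤ R) :
    ‖GN N p C - (GLimit ρ r : ℂ)‖ ≤ 12 * (logBound ρ R + Real.pi) / ρ / N := by
  have hπ := Real.pi_pos
  have hN' : (0 : ℝ) < N := by exact_mod_cast hN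
  have hp0' : (0 : ℝ) < p := by rw [hp]; positivity
  have hr0 : 0 < r := by rw [hr]; have := abs_pos.2 hC0; positivity
  have h0 := (tendsto_real_end hρ0 hρ1 hr0 (ψ₀ := 0) nhdsWithin_le_nhds
    (Ioo_mem_nhdsGT (by positivity)) (tendsto_arg_levelPoint_zero hρ0 hρ1 hr0)).2.2
  have key := norm_sum_betheRoot_sub_le (f := fun u => Complex.log (1 + u))
    (M := logBound ρ R + Real.pi) hρ0 hρ1 hN hp hC0 hC hr hrR hR
    (fun u hu => hasDerivAt_primG ρ hu) (antitoneOn_re_log_levelPoint hρ0 hρ1 hr0)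
    (fun u hu => by
      rw [← Complex.log_conj, map_add, map_one]
      exact Complex.slitPlane_arg_ne_pi (one_add_mem_slitPlane hu))
    (fun u h1 h2 => by
      refine (Complex.norm_le_abs_re_add_abs_im _).trans ?_
      rw [Complex.log_re, Complex.log_im]
      exact add_le_add (abs_log_norm_le hρ0 hρ1 h1 h2) (Complex.abs_arg_le_pi _))
    h0 (tendsto_primG_end hρ0 hρ1 hr0)
  -- The lower end ψ = 0 contributes p log 2, which the -log 2 in the definition of G_N cancels.
  have e1 : (N : ℝ) / Real.pi * (ρ * Real.pi * GLimit ρ r - Real.log 2 * (0 - ρ * Real.pi))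
      = p * (GLimit ρ r + Real.log 2) := by
    rw [hp]; field_simp; ring
  rw [e1] at key
  have hpC : (p : ℂ) ≠ 0 := by exact_mod_cast hp0'.ne'
  have e2 : GN N p C - (GLimit ρ r : ℂ) = (p : ℂ)⁻¹ *
      (∑ j ∈ Finset.Icc 1 p, Complex.log (1 + betheRoot N p j C)
        - ((p * (GLimit ρ r + Real.log 2) : ℝ) : ℂ)) := by
    have hlog : Complex.log 2 = ((Real.log 2 : ℝ) : ℂ) := by
      rw [Complex.ofReal_log (by norm_num)]; norm_num
    rw [GN, hlog]
    push_cast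
    field_simp
    ring
  rw [e2, norm_mul, norm_inv, Complex.norm_natCast, div_div, ← hp, inv_mul_eq_div]
  gcongr

lemma norm_LambdaN_sub_le (hρ0 : 0 < ρ) (hρ1 : ρ < 1) (hN : 0 < N) (hp : (p : ℝ) = ρ * N)
    (hC0 : C ≠ 0) (hC : C ≤ rCrit ρ ^ p) (hr : r = |C| ^ (1 / (p : ℝ))) (hrR : r ≤ R)
    (hR : 1 ≤ R) :
    ‖LambdaN N p C - (N : ℂ) * (LambdaLimit ρ r : ℂ)‖ ≤ 6 * (2 + R) := by
  have hπ := Real.pi_pos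
  have hr0 : 0 < r := by rw [hr]; have := abs_pos.2 hC0; positivity
  have h0 := (tendsto_real_end hρ0 hρ1 hr0 (ψ₀ := 0) nhdsWithin_le_nhds
    (Ioo_mem_nhdsGT (by positivity)) (tendsto_arg_levelPoint_zero hρ0 hρ1 hr0)).2.1
  have key := norm_sum_betheRoot_sub_le (f := fun u => u - 1)
    (M := 2 + R) hρ0 hρ1 hN hp hC0 hC hr hrR hR
    (fun u hu => hasDerivAt_primLambda ρ hu)
    (fun x hx y hy hxy => by
      have := antitoneOn_re_levelPoint hρ0 hρ1 hr0 hx hy hxy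
      simpa using this)
    (fun u hu => by simp)
    (fun u h1 h2 => by
      have := norm_sub_le u 1
      rw [norm_one] at this; linarith)
    h0 (tendsto_primLambda_end hρ0 hρ1 hr0)
  have e1 : (N : ℝ) / Real.pi * (2 * Real.pi * LambdaLimit ρ r - 0)
      = 2 * (N * LambdaLimit ρ r) := by
    field_simp; ring
  rw [e1] at key
  have e2 : LambdaN N p C - (N : ℂ) * (LambdaLimit ρ r : ℂ) = (1 / 2 : ℂ) *
      (∑ j ∈ Finset.Icc 1 p, (betheRoot N p j C - 1)
        - ((2 * (N * LambdaLimit ρ r) : ℝ) : ℂ)) := by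
    rw [LambdaN]; push_cast; ring
  rw [e2, norm_mul]
  have : ‖(1 / 2 : ℂ)‖ = 1 / 2 := by norm_num
  rw [this]
  linarith

lemma GN_zero (hp0 : 0 < p) : GN N p 0 = 0 := by
  have hpC : (p : ℂ) ≠ 0 := by exact_mod_cast hp0.ne'
  have : ∑ j ∈ Finset.Icc 1 p, Complex.log (1 + betheRoot N p j 0) = p * Complex.log 2 := by
    rw [Finset.sum_congr rfl (g := fun _ => Complex.log 2)]
    · simp
    · intro j hj
      rw [betheRoot, if_pos rfl, if_pos (Finset.mem_Icc.1 hj).2]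
      norm_num
  rw [GN, this]
  field_simp
  ring

lemma LambdaN_zero : LambdaN N p 0 = 0 := by
  rw [LambdaN, Finset.sum_eq_zero, mul_zero]
  intro j hj
  rw [betheRoot, if_pos rfl, if_pos (Finset.mem_Icc.1 hj).2, sub_self]

lemma radius_le (hp0 : 0 < p) (hR : 1 ≤ R) (hr : r = |C| ^ (1 / (p : ℝ))) (hC : |C| ≤ R) :
    r ≤ R := by
  have h1 : (1 : ℝ) ≤ p := by exact_mod_cast hp0
  calc r = |C| ^ (1 / (p : ℝ)) := hr
    _ ≤ R ^ (1 / (p : ℝ)) := Real.rpow_le_rpow (abs_nonneg _) hC (by positivity)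
    _ ≤ R ^ (1 : ℝ) := Real.rpow_le_rpow_of_exponent_le hR ((div_le_one (by linarith)).2 h1)
    _ = R := Real.rpow_one R

end Bounds

end TASEP

end

/-- The density `ρ = p/N` is fixed. The bound `B` depends only on `ρ` and on the compact set `K`;
it is uniform over all system sizes and over all admissible `C` such that `C` itself or the
focal radius `r = |C|^(1/p)` lies in `K`. -/
theorem proposition4p3 (ρ : ℝ) (hρ0 : 0 < ρ) (hρ1 : ρ < 1) (K : Set ℝ) (hK : IsCompact K) :
    ∃ B : ℝ, ∀ N p : ℕ, 0 < N → (p : ℝ) = ρ * N →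
      ∀ C r : ℝ, C ≤ TASEP.rCrit ρ ^ p → r = |C| ^ (1 / (p : ℝ)) → (C ∈ K ∨ r ∈ K) →
        ‖TASEP.GN N p (C : ℂ) - (TASEP.GLimit ρ r : ℂ)‖ ≤ B / N ∧
        ‖TASEP.LambdaN N p (C : ℂ) - (N : ℂ) * (TASEP.LambdaLimit ρ r : ℂ)‖ ≤ B := by
  obtain ⟨R₀, hR₀⟩ := hK.isBounded.exists_norm_le
  set R := max 1 R₀
  have hR : 1 ≤ R := le_max_left _ _
  have hKR : ∀ x ∈ K, |x| ≤ R := fun x hx => (hR₀ x hx).trans (le_max_right _ _)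
  have hπ := Real.pi_pos
  have hlog : 0 ≤ TASEP.logBound ρ R := by unfold TASEP.logBound; positivity
  have hB1 : 0 ≤ 12 * (TASEP.logBound ρ R + Real.pi) / ρ := by positivity
  have hB2 : 0 ≤ 6 * (2 + R) := by positivity
  refine ⟨12 * (TASEP.logBound ρ R + Real.pi) / ρ + 6 * (2 + R), ?_⟩
  intro N p hN hp C r hC hr hCr
  have hp0 := TASEP.pos_of_density hρ0 hN hp
  -- The level curve needs r > 0. At C = 0 all p roots equal 1 and both differences vanish.
  rcases eq_or_ne C 0 with rfl | hC0
  · have hp' : (1 / (p : ℝ)) ≠ 0 := by positivity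
    have hr0 : r = 0 := by rw [hr, abs_zero, Real.zero_rpow hp']
    have hlt : ¬ TASEP.rCrit ρ < r := by
      rw [hr0]; exact (TASEP.rCrit_pos hρ0 hρ1).not_gt
    rw [TASEP.GLimit, if_neg hlt, TASEP.LambdaLimit, if_neg hlt, Complex.ofReal_zero,
      TASEP.GN_zero hp0, TASEP.LambdaN_zero, mul_zero, sub_zero, norm_zero]
    exact ⟨by positivity, by positivity⟩
  · have hrR : r ≤ R := by
      rcases hCr with h | h
      · exact TASEP.radius_le hp0 hR hr (hKR C h)
      · exact (le_abs_self r).trans (hKR r h)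
    constructor
    · refine (TASEP.norm_GN_sub_le hρ0 hρ1 hN hp hC0 hC hr hrR hR).trans ?_
      gcongr
      linarith
    · exact (TASEP.norm_LambdaN_sub_le hρ0 hρ1 hN hp hC0 hC hr hrR hR).trans (by linarith)
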